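/- **Computational Pinsker's inequality.** *Functions up to negligible differences.* For $f,g\colon\mathbb N\to[-\infty,\infty]$ let $$d(f,g)=\limsup_{n\to\infty}\,|f(n)-g(n)|^{1/\log n}$$ (the term being $0$ when $f(n)=g(n)$). A function $h\colon\mathbb N\to\mathbb R$ is *negligible* if $d(h,0)=0$, i.e. if it vanishes faster than every inverse polynomial. Write $f\simeq g$ if $d(f,g)=0$, and $f\lesssim g$ if there is a negligible $h$ with $f(n)\le g(n)+h(n)$ for all large $n$. Limits $\lim_a f_a\simeq F$ are limits in the pseudometric: $d(f_a,F)\to 0$. A function $F$ is $\liminf_{k} f_k$ if it is a least upper bound, for $\lesssim$, of the functions $g$ with $g\lesssim f_k$ for all large $k$. *Complexity-limited tests.* On a register of qubits, the gate complexity $C(U)$ of a unitary $U$ is the least number of unitaries, each acting on at most two (arbitrary) qubits, whose product is $U$. For a multi-qubit space $\mathcal H$ let $\mathcal Q(\mathcal H;G)$ be the set of effects $\langle 0|_{\rm anc}\,U\big[\bigotimes_i A_i\big]U^\dagger\,|0\rangle_{\rm anc}$, with any finite number of ancilla qubits, $C(U)\le G$ and $A_i\in\{|0\rangle\langle 0|,\mathbb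 I\}$. For states $\rho,\sigma$ on $\mathcal H$ put $$d_{\rm TV}(\rho,\sigma;G)=\max_{\Lambda\in\mathcal Q(\mathcal H;G)}\operatorname{Tr}[\Lambda(\rho-\sigma)],\qquad D_h^\epsilon(\rho\|\sigma;G)=-\log\min_{\Lambda\in\mathcal Q(\mathcal H;G)}\{\operatorname{Tr}[\Lambda\sigma]:\operatorname{Tr}[\Lambda\rho]\ge 1-\epsilon\}$$ (natural logarithm, $-\log 0=+\infty$). *Computational quantities.* Let $\rho_n,\sigma_n$, $n\in\mathbb N$, be states on $\mathcal H_n=(\mathbb C^2)^{\otimes q(n)}$. In the sense of limits above, define $$\underline d_{\rm TV}(\rho_n,\sigma_n)\simeq\lim_{\ell\to\infty}d_{\rm TV}(\rho_n,\sigma_n;n^\ell),\qquad \underline D(\rho_n\|\sigma_n)\simeq\lim_{\epsilon\to0}\lim_{\ell\to\infty}\liminf_{k\to\infty}\frac1{n^k}D_h^\epsilon\big(\rho_n^{\otimes n^k}\big\|\sigma_n^{\otimes n^k};n^{k\ell}\big).$$ **Theorem.** Let $\rho_n,\sigma_n$ be states on $q(n)$ qubits, where $q(n)\le n^{c}$ for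 some $c$ and all large $n$. 1. Whenever the limits defining the two quantities exist, $$\underline d_{\rm TV}(\rho_n,\sigma_n)\lesssim\sqrt{\tfrac12\,\underline D(\rho_n\|\sigma_n)}.$$ 2. In any case, whether or not these limits exist, the inequality holds for the approximating quantities: for all $\ell_0\in\mathbb N$ and $\epsilon\in(0,1)$ there is $\ell_1$ such that for all $\ell\ge\ell_1$, all $j\in\mathbb N$ and all sufficiently large $k$ (depending on $j$), $$d_{\rm TV}(\rho_n,\sigma_n;n^{\ell_0})\lesssim\sqrt{\tfrac12\cdot\tfrac1{n^k}D_h^\epsilon\big(\rho_n^{\otimes n^k}\big\|\sigma_n^{\otimes n^k};n^{k\ell}\big)}+n^{-j}.$$ -/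

import Mathlib

open Filter Topology
open scoped ENNReal ComplexOrder

noncomputable section

namespace CompInfo

/-! ### Functions up to negligible differences

The quantities of interest are functions of the scaling parameter `n`.  They take values in
`EReal`, because a hypothesis testing relative entropy equals `+∞` as soon as some admissible
effect has type II error `0`. -/

/-- The asymptotic-exponent pseudometric
`d(f, g) = limsup_n |f(n) - g(n)| ^ (1 / log n) = limsup_n exp (log |f(n) - g(n)| / log n)`,
where the term is `0` if `f(n) = g(n)`. -/
def asympDist (f g : ℕ → EReal) : ℝ≥0∞ :=
  limsup (fun n : ℕ => if f n = g n then 0 else (f n - g n).abs ^ (1 / Real.log (n : ℝ))) atTop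

/-- A real function is negligible if its distance from the zero function vanishes. -/
def IsNegligible (h : ℕ → ℝ) : Prop :=
  asympDist (fun n => (h n : EReal)) (fun _ => 0) = 0

/-- `f ≲ g`: there is a negligible `h` with `f ≤ g + h`.  As `h` may be changed at finitely many
`n`, it is enough that the inequality holds for all large `n`. -/
def NeglLE (f g : ℕ → EReal) : Prop :=
  ∃ h : ℕ → ℝ, IsNegligible h ∧ ∀ᶠ n in atTop, f n ≤ g n + (h n : EReal)

infix:50 " ≲ₙ " => NeglLE

/-- `F` is the limit of the family `f` along the filter `l` in the pseudometric `asympDist`. -/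
def IsNeglLim {α : Type} (l : Filter α) (f : α → ℕ → EReal) (F : ℕ → EReal) : Prop :=
  Tendsto (fun a => asympDist (f a) F) l (𝓝 0)

/-- `F` is the limit inferior of the sequence of functions `f 0, f 1, …` with respect to the
order `≲`: the least upper bound of all `g` with `g ≲ f k` for all large `k`. -/
def IsNeglLiminf (f : ℕ → ℕ → EReal) (F : ℕ → EReal) : Prop :=
  (∀ g : ℕ → EReal, (∀ᶠ k in atTop, g ≲ₙ f k) → g ≲ₙ F) ∧
    ∀ u : ℕ → EReal, (∀ g : ℕ → EReal, (∀ᶠ k in atTop, g ≲ₙ f k) → g ≲ₙ u) → F ≲ₙ u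

/-- The square root on `[0, ∞]`, extended by `0` to negative numbers. -/
def esqrt (x : EReal) : EReal :=
  ((x.toENNReal ^ (1 / 2 : ℝ) : ℝ≥0∞) : EReal)

/-! ### Qubit registers, gates and effects

The register indexed by `ι` has the Hilbert space `(ℂ²)^{⊗ ι}`, with computational basis
`ι → Fin 2`; its operators are the matrices in this basis. -/

/-- Operators on the qubit register indexed by `ι`. -/
abbrev Op (ι : Type) : Type := Matrix (ι → Fin 2) (ι → Fin 2) ℂ

/-- Quantum states: density matrices. -/
def IsState {ι : Type} [Fintype ι] [DecidableEq ι] (ρ : Op ι) : Prop :=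
  ρ.PosSemidef ∧ ρ.trace = 1

/-- The tensor product `⨂ᵢ Aᵢ` of one-qubit operators. -/
def tensorOp {ι : Type} [Fintype ι] (A : ι → Matrix (Fin 2) (Fin 2) ℂ) : Op ι :=
  Matrix.of fun x y => ∏ i, A i (x i) (y i)

/-- The tensor power `ρ^{⊗ m}`; qubit `i` of copy `c` has index `(c, i)`. -/
def tensorPow {ι : Type} (ρ : Op ι) (m : ℕ) : Op (Fin m × ι) :=
  Matrix.of fun x y => ∏ c : Fin m, ρ (fun i => x (c, i)) (fun i => y (c, i))

/-- `U` acts as some operator `V` on the qubits `i`, `j` and as the identity on all other qubits.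
The case `i = j` gives the one-qubit gates. -/
def IsTwoLocal {ι : Type} [Fintype ι] [DecidableEq ι] (U : Op ι) : Prop :=
  ∃ (i j : ι) (V : Matrix (Fin 2 × Fin 2) (Fin 2 × Fin 2) ℂ), ∀ x y : ι → Fin 2,
    U x y = if ∀ k, k ≠ i → k ≠ j → x k = y k then V (x i, x j) (y i, y j) else 0

/-- The gate complexity `C(U)`: the least number of two-local unitaries whose product is `U`. -/
def gateComplexity {ι : Type} [Fintype ι] [DecidableEq ι]
    (U : Matrix.unitaryGroup (ι → Fin 2) ℂ) : ℕ∞ :=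
  ⨅ (L : List (Matrix.unitaryGroup (ι → Fin 2) ℂ))
    (_ : (∀ g ∈ L, IsTwoLocal (g : Op ι)) ∧ L.prod = U), (L.length : ℕ∞)

/-- The one-qubit projector `|0⟩⟨0|`. -/
def ketbraZero : Matrix (Fin 2) (Fin 2) ℂ := Matrix.single 0 0 1

/-- `⟨0|_anc M |0⟩_anc` for an operator `M` on a register together with `a` ancilla qubits. -/
def ancZero {ι : Type} {a : ℕ} (M : Op (ι ⊕ Fin a)) : Op ι :=
  Matrix.of fun x y => M (Sum.elim x fun _ => 0) (Sum.elim y fun _ => 0)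

/-- The `G`-complexity effects: all `⟨0|_anc U (⨂ᵢ Aᵢ) U† |0⟩_anc` with any number of ancilla
qubits, `C(U) ≤ G`, and `Aᵢ ∈ {|0⟩⟨0|, 𝟙}`. -/
def effects (ι : Type) [Fintype ι] [DecidableEq ι] (G : ℕ) : Set (Op ι) :=
  {Λ | ∃ (a : ℕ) (U : Matrix.unitaryGroup (ι ⊕ Fin a → Fin 2) ℂ)
      (A : ι ⊕ Fin a → Matrix (Fin 2) (Fin 2) ℂ),
      gateComplexity U ≤ (G : ℕ∞) ∧ (∀ i, A i = ketbraZero ∨ A i = 1) ∧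
        Λ = ancZero ((U : Op (ι ⊕ Fin a)) * tensorOp A * (U : Op (ι ⊕ Fin a)).conjTranspose)}

/-- `Tr[Λ X]`; it is real for the Hermitian `Λ`, `X` to which it is applied. -/
def expect {ι : Type} [Fintype ι] [DecidableEq ι] (Λ X : Op ι) : ℝ := (Λ * X).trace.re

/-! ### Complexity-limited distinguishability -/

/-- The `G`-complexity total variation distance `d_TV(ρ, σ; G) = max_Λ Tr[Λ (ρ - σ)]`. -/
def dTV {ι : Type} [Fintype ι] [DecidableEq ι] (ρ σ : Op ι) (G : ℕ) : EReal :=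
  ⨆ Λ ∈ effects ι G, (expect Λ (ρ - σ) : EReal)

/-- The `G`-complexity hypothesis testing relative entropy
`D_h^ε(ρ‖σ; G) = -log min {Tr[Λ σ] | Tr[Λ ρ] ≥ 1 - ε}`, with `-log 0 = +∞`. -/
def hypRelEnt {ι : Type} [Fintype ι] [DecidableEq ι] (ε : ℝ) (ρ σ : Op ι) (G : ℕ) : EReal :=
  -ENNReal.log (⨅ Λ ∈ {Λ ∈ effects ι G | 1 - ε ≤ expect Λ ρ}, ENNReal.ofReal (expect Λ σ))

/-- Families `ρ_n` of operators, the `n`-th one on `q n` qubits. -/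
abbrev OpFamily (q : ℕ → ℕ) : Type := (n : ℕ) → Op (Fin (q n))

/-- The function `n ↦ d_TV(ρ_n, σ_n; n ^ ℓ)`. -/
def polyTV {q : ℕ → ℕ} (ρ σ : OpFamily q) (ℓ : ℕ) : ℕ → EReal :=
  fun n => dTV (ρ n) (σ n) (n ^ ℓ)

/-- The function `n ↦ n ^ (-k) * D_h^ε(ρ_n^{⊗ n ^ k} ‖ σ_n^{⊗ n ^ k}; n ^ (k ℓ))`. -/
def polyRelEnt {q : ℕ → ℕ} (ρ σ : OpFamily q) (ε : ℝ) (ℓ k : ℕ) : ℕ → EReal :=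
  fun n => hypRelEnt ε (tensorPow (ρ n) (n ^ k)) (tensorPow (σ n) (n ^ k)) (n ^ (k * ℓ)) /
    ((n ^ k : ℕ) : EReal)

/-- `T` is (a representative of) the computational total variation distance
`lim_{ℓ → ∞} d_TV(ρ_n, σ_n; n ^ ℓ)`. -/
def IsCompTV {q : ℕ → ℕ} (ρ σ : OpFamily q) (T : ℕ → EReal) : Prop :=
  IsNeglLim atTop (fun ℓ => polyTV ρ σ ℓ) T

/-- `D` is (a representative of) the computational relative entropy
`lim_{ε → 0} lim_{ℓ → ∞} liminf_{k → ∞} n ^ (-k) * D_h^ε(ρ_n^{⊗ n ^ k} ‖ σ_n^{⊗ n ^ k}; n ^ (k ℓ))`;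
`E ε ℓ` is the limit inferior in `k`, and `E' ε` the limit of `E ε ℓ` in `ℓ`. -/
def IsCompRelEnt {q : ℕ → ℕ} (ρ σ : OpFamily q) (D : ℕ → EReal) : Prop :=
  ∃ (E : ℝ → ℕ → ℕ → EReal) (E' : ℝ → ℕ → EReal),
    (∀ᶠ ε in 𝓝[>] (0 : ℝ),
      (∀ᶠ ℓ in atTop, IsNeglLiminf (fun k => polyRelEnt ρ σ ε ℓ k) (E ε ℓ)) ∧
        IsNeglLim atTop (fun ℓ => E ε ℓ) (E' ε)) ∧
      IsNeglLim (𝓝[>] (0 : ℝ)) E' D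

end CompInfo

end

open CompInfo

namespace CompInfo

/-! ### Circuits of two-local unitaries -/

/-! The inequality comes from repeating a good distinguishing test. Let `Λ` be an effect of
complexity `G` with advantage δ = Tr[Λ(ρ - σ)]. Apply it to each of `m` copies and accept if at
least m(Tr[Λρ] - s) copies accept. By Hoeffding's inequality (`sum_threshold_le`) the type I error
is at most exp(-2ms²) and the type II error at most exp(-2m(δ - s)²). Once exp(-2ms²) ≤ ε, the
hypothesis testing relative entropy per copy is therefore at least 2(δ - s)² (`sq_le_hypRelEnt`).
For m = n^k and s = n^(-j) this holds for every fixed ε > 0, large `n` and k ≥ 2j + 1.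

The work lies in the gate count, since the repeated test must again be a measurement of zeros after
few two-local unitaries. Counting the failing copies is the run of a finite automaton. Its state is
stored one-hot in fresh qubits at every time step, so a transition is a list of Toffoli gates
(`exists_automaton_circuit`). The cost also depends on the number of qubits measured by `Λ`, and
`exists_of_mem_effects` bounds it although the number of ancillas is arbitrary. Altogether
`exists_threshold_effect` needs about m³(q + G) gates, which is below n^(kℓ) for ℓ ≥ 5 and large `k`
(`circuit_size_le`).

The lower bound 2(δ - s)² does not depend on `k`. It is thus a competitor in the definition of the
limit inferior, and it survives the limits in ℓ and ε up to errors n^(-2j), which become n^(-j)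
under the square root (`le_esqrt_of_sq_le`). -/

/-- `M` is a product of at most `G` two-local unitaries. -/
def HasCircuit {ι : Type} [Fintype ι] [DecidableEq ι] (G : ℕ) (M : Op ι) : Prop :=
  ∃ L : List (Op ι), (∀ g ∈ L, IsTwoLocal g ∧ g ∈ Matrix.unitaryGroup (ι → Fin 2) ℂ) ∧
    L.length ≤ G ∧ L.prod = M

section Circuits

variable {ι : Type} [Fintype ι] [DecidableEq ι]

theorem HasCircuit.one : HasCircuit 0 (1 : Op ι) := ⟨[], by simp⟩

theorem HasCircuit.mono {G G' : ℕ} {M : Op ι} (h : HasCircuit G M) (hG : G ≤ G') :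
    HasCircuit G' M := by
  obtain ⟨L, h1, h2, h3⟩ := h
  exact ⟨L, h1, h2.trans hG, h3⟩

theorem HasCircuit.mul {G G' : ℕ} {M N : Op ι} (h : HasCircuit G M) (h' : HasCircuit G' N) :
    HasCircuit (G + G') (M * N) := by
  obtain ⟨L, h1, h2, h3⟩ := h
  obtain ⟨L', h1', h2', h3'⟩ := h'
  refine ⟨L ++ L', ?_, ?_, ?_⟩
  · intro g hg
    rcases List.mem_append.1 hg with hg | hg
    exacts [h1 g hg, h1' g hg]
  · rw [List.length_append]; omega
  · rw [List.prod_append, h3, h3']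

theorem HasCircuit.of_gate {M : Op ι} (h : IsTwoLocal M)
    (hM : M ∈ Matrix.unitaryGroup (ι → Fin 2) ℂ) : HasCircuit 1 M :=
  ⟨[M], by simpa using ⟨h, hM⟩, by simp, by simp⟩

theorem HasCircuit.mem_unitaryGroup {G : ℕ} {M : Op ι} (h : HasCircuit G M) :
    M ∈ Matrix.unitaryGroup (ι → Fin 2) ℂ := by
  obtain ⟨L, h1, -, rfl⟩ := h
  exact Submonoid.list_prod_mem _ fun g hg => (h1 g hg).2

theorem HasCircuit.map {κ : Type} [Fintype κ] [DecidableEq κ] (f : Op ι →* Op κ)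
    (hf : ∀ g, IsTwoLocal g → g ∈ Matrix.unitaryGroup (ι → Fin 2) ℂ →
      IsTwoLocal (f g) ∧ f g ∈ Matrix.unitaryGroup (κ → Fin 2) ℂ)
    {G : ℕ} {M : Op ι} (h : HasCircuit G M) : HasCircuit G (f M) := by
  obtain ⟨L, h1, h2, rfl⟩ := h
  refine ⟨L.map f, ?_, by simpa using h2, (map_list_prod f L).symm⟩
  intro g hg
  obtain ⟨g', hg', rfl⟩ := List.mem_map.1 hg
  exact hf g' (h1 g' hg').1 (h1 g' hg').2

/-- Lengths are natural numbers: if no circuit had length at most `G`, the infimum would be at least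
`G + 1`. So a bound on the infimum always yields an actual circuit. -/
theorem gateComplexity_le_iff (U : Matrix.unitaryGroup (ι → Fin 2) ℂ) (G : ℕ) :
    gateComplexity U ≤ (G : ℕ∞) ↔ HasCircuit G (U : Op ι) := by
  constructor
  · intro h
    by_contra hc
    have : ((G + 1 : ℕ) : ℕ∞) ≤ gateComplexity U := by
      refine le_iInf₂ fun L hL => ?_
      by_contra hlt
      have hlen : L.length ≤ G := by
        have := not_le.1 hlt
        rw [Nat.cast_lt] at this
        omega
      refine hc ⟨L.map (Matrix.unitaryGroup (ι → Fin 2) ℂ).subtype, ?_, by simpa using hlen, ?_⟩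
      · intro g hg
        obtain ⟨g', hg', rfl⟩ := List.mem_map.1 hg
        exact ⟨hL.1 g' hg', g'.2⟩
      · rw [← hL.2]
        exact (map_list_prod (Matrix.unitaryGroup (ι → Fin 2) ℂ).subtype L).symm
    have h2 := this.trans h
    rw [Nat.cast_le] at h2
    omega
  · rintro ⟨L, h1, h2, h3⟩
    lift L to List (Matrix.unitaryGroup (ι → Fin 2) ℂ) using fun g hg => (h1 g hg).2
    have hL : (∀ g ∈ L, IsTwoLocal (g : Op ι)) ∧ L.prod = U :=
      ⟨fun g hg => (h1 g (List.mem_map.2 ⟨g, hg, rfl⟩)).1, Subtype.ext <| h3 ▸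
        map_list_prod (Matrix.unitaryGroup (ι → Fin 2) ℂ).subtype L⟩
    exact (iInf₂_le L hL).trans (by exact_mod_cast (by simpa using h2))

/-! ### Operators acting on a single target qubit -/

/-- The operator which applies `v x` to the qubit `t`, where `x` are the other qubits. -/
def controlled (t : ι) (v : (ι → Fin 2) → Matrix (Fin 2) (Fin 2) ℂ) : Op ι :=
  Matrix.of fun x y =>
    if ∀ k, k ≠ t → x k = y k then v (Function.update x t 0) (x t) (y t) else 0

theorem sum_agree_off {M : Type*} [AddCommMonoid M] (t : ι) (x : ι → Fin 2)
    (g : (ι → Fin 2) → M) :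
    ∑ z, (if ∀ k, k ≠ t → x k = z k then g z else 0) = ∑ b, g (Function.update x t b) := by
  rw [← Finset.sum_filter]
  have : Finset.univ.filter (fun z : ι → Fin 2 => ∀ k, k ≠ t → x k = z k) =
      Finset.univ.map ⟨Function.update x t, Function.update_injective x t⟩ := by
    ext z
    simp only [Finset.mem_filter, Finset.mem_univ, true_and, Finset.mem_map,
      Function.Embedding.coeFn_mk]
    constructor
    · intro h
      refine ⟨z t, ?_⟩
      ext k
      by_cases hk : k = t
      · subst hk; simp
      · simp [hk, h k hk]
    · rintro ⟨b, rfl⟩ k hk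
      simp [hk]
  rw [this, Finset.sum_map]
  rfl

omit [Fintype ι] in
theorem update_eq_update_of_agree {t : ι} {x y : ι → Fin 2} (h : ∀ k, k ≠ t → x k = y k)
    (b : Fin 2) : Function.update x t b = Function.update y t b := by
  ext k
  by_cases hk : k = t
  · subst hk; simp
  · simp [hk, h k hk]

/-- The control `v` reads its argument with qubit `t` reset to `0`, so neither factor changes what
the other one reads, and the 2 × 2 blocks multiply separately. -/
theorem controlled_mul (t : ι) (v w : (ι → Fin 2) → Matrix (Fin 2) (Fin 2) ℂ) :
    controlled t v * controlled t w = controlled t (fun x => v x * w x) := by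
  ext x y
  rw [Matrix.mul_apply]
  simp only [controlled, Matrix.of_apply, ite_mul, zero_mul]
  rw [sum_agree_off]
  have hag : ∀ b, (∀ k, k ≠ t → Function.update x t b k = y k) ↔ ∀ k, k ≠ t → x k = y k := by
    intro b
    refine forall_congr' fun k => forall_congr' fun hk => ?_
    simp [hk]
  simp only [hag, Function.update_self, Function.update_idem, Matrix.mul_apply]
  split_ifs <;> simp

theorem controlled_one (t : ι) : controlled t (fun _ => 1) = (1 : Op ι) := by
  ext x y
  simp only [controlled, Matrix.of_apply, Matrix.one_apply]
  by_cases h : x = y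
  · subst h; simp
  · by_cases h1 : ∀ k, k ≠ t → x k = y k
    · have : x t ≠ y t := by
        intro h2
        apply h
        ext k
        by_cases hk : k = t
        · rw [hk, h2]
        · rw [h1 k hk]
      simp [this, h]
    · simp [h1, h]

theorem controlled_conjTranspose (t : ι) (v : (ι → Fin 2) → Matrix (Fin 2) (Fin 2) ℂ) :
    (controlled t v).conjTranspose = controlled t (fun x => (v x).conjTranspose) := by
  ext x y
  simp only [controlled, Matrix.of_apply, Matrix.conjTranspose_apply]
  by_cases h : ∀ k, k ≠ t → x k = y k
  · have h' : ∀ k, k ≠ t → y k = x k := fun k hk => (h k hk).symm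
    rw [if_pos h, if_pos h', update_eq_update_of_agree h]
  · have h' : ¬ ∀ k, k ≠ t → y k = x k := fun h' => h fun k hk => (h' k hk).symm
    rw [if_neg h, if_neg h', star_zero]

theorem controlled_mem_unitaryGroup (t : ι) {v : (ι → Fin 2) → Matrix (Fin 2) (Fin 2) ℂ}
    (hv : ∀ x, v x * (v x).conjTranspose = 1) :
    controlled t v ∈ Matrix.unitaryGroup (ι → Fin 2) ℂ := by
  rw [Matrix.mem_unitaryGroup_iff, Matrix.star_eq_conjTranspose, controlled_conjTranspose,
    controlled_mul]
  simp only [hv, controlled_one]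

theorem isTwoLocal_controlled (t a : ι) (f : Fin 2 → Matrix (Fin 2) (Fin 2) ℂ) :
    a ≠ t → IsTwoLocal (controlled t fun x => f (x a)) := by
  intro hat
  refine ⟨t, a, Matrix.of fun p p' => if p.2 = p'.2 then f p.2 p.1 p'.1 else 0, fun x y => ?_⟩
  simp only [controlled, Matrix.of_apply, Function.update_of_ne hat]
  by_cases h : ∀ k, k ≠ t → x k = y k
  · have h1 : ∀ k, k ≠ t → k ≠ a → x k = y k := fun k hk _ => h k hk
    rw [if_pos h, if_pos h1, if_pos (h a hat)]
  · rw [if_neg h]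
    split_ifs with h1 h2
    · refine absurd (fun k hk => ?_) h
      by_cases hka : k = a
      · rw [hka, h2]
      · exact h1 k hk hka
    · rfl
    · rfl

theorem isTwoLocal_controlled_const (t : ι) (f : Matrix (Fin 2) (Fin 2) ℂ) :
    IsTwoLocal (controlled t fun _ => f) := by
  refine ⟨t, t, Matrix.of fun p p' => f p.1 p'.1, fun x y => ?_⟩
  simp only [controlled, Matrix.of_apply]
  congr 1
  simp

/-! ### Classical reversible gates -/

/-- The circuit cost of a map `φ` of the computational basis. -/
def HasClassicalCircuit (G : ℕ) (φ : (ι → Fin 2) → (ι → Fin 2)) : Prop :=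
  ∃ C : Op ι, HasCircuit G C ∧
    ∀ d : (ι → Fin 2) → ℂ, C * Matrix.diagonal d * C.conjTranspose = Matrix.diagonal (d ∘ φ)

theorem HasClassicalCircuit.id : HasClassicalCircuit 0 (id : (ι → Fin 2) → (ι → Fin 2)) :=
  ⟨1, HasCircuit.one, fun d => by simp⟩

/-- Conjugation pulls diagonals back, d ↦ d ∘ φ, which is contravariant. The circuit of the map
applied first is therefore the outer factor. -/
theorem HasClassicalCircuit.comp {G G' : ℕ} {φ ψ : (ι → Fin 2) → (ι → Fin 2)}
    (hψ : HasClassicalCircuit G ψ) (hφ : HasClassicalCircuit G' φ) :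
    HasClassicalCircuit (G + G') (ψ ∘ φ) := by
  obtain ⟨C, h1, h2⟩ := hψ
  obtain ⟨C', h1', h2'⟩ := hφ
  refine ⟨C' * C, by rw [add_comm]; exact h1'.mul h1, fun d => ?_⟩
  rw [Matrix.conjTranspose_mul]
  calc C' * C * Matrix.diagonal d * (C.conjTranspose * C'.conjTranspose)
      = C' * (C * Matrix.diagonal d * C.conjTranspose) * C'.conjTranspose := by
        simp only [Matrix.mul_assoc]
    _ = _ := by rw [h2, h2']; rfl

theorem HasClassicalCircuit.mono {G G' : ℕ} {φ : (ι → Fin 2) → (ι → Fin 2)} (hG : G ≤ G')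
    (h : HasClassicalCircuit G φ) : HasClassicalCircuit G' φ := by
  obtain ⟨C, h1, h2⟩ := h
  exact ⟨C, h1.mono hG, h2⟩

/-- Flip the qubit `t` if the other qubits satisfy `p`. -/
def flipIf (t : ι) (p : (ι → Fin 2) → Prop) [DecidablePred p] (x : ι → Fin 2) : ι → Fin 2 :=
  if p (Function.update x t 0) then Function.update x t (x t + 1) else x

/-- The Pauli matrix `X`. -/
def pauliX : Matrix (Fin 2) (Fin 2) ℂ := !![0, 1; 1, 0]

/-- A unitary square root of `X`. -/
noncomputable def sqrtX : Matrix (Fin 2) (Fin 2) ℂ :=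
  !![(1 + Complex.I) / 2, (1 - Complex.I) / 2; (1 - Complex.I) / 2, (1 + Complex.I) / 2]

theorem pauliX_conjTranspose : pauliX.conjTranspose = pauliX := by
  ext i j; fin_cases i <;> fin_cases j <;> simp [pauliX]

theorem pauliX_mul_self : pauliX * pauliX = 1 := by
  ext i j; fin_cases i <;> fin_cases j <;> simp [pauliX]

theorem sqrtX_mul_self : sqrtX * sqrtX = pauliX := by
  ext i j; fin_cases i <;> fin_cases j <;>
    simp [pauliX, sqrtX, Matrix.mul_apply, Fin.sum_univ_two] <;> ring_nf <;> norm_num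

theorem sqrtX_mul_conjTranspose : sqrtX * sqrtX.conjTranspose = 1 := by
  ext i j; fin_cases i <;> fin_cases j <;>
    simp [sqrtX, Matrix.mul_apply, Fin.sum_univ_two, Complex.conj_ofNat] <;> ring_nf <;> norm_num

theorem pauliX_apply (a b : Fin 2) : pauliX a b = if a + 1 = b then 1 else 0 := by
  fin_cases a <;> fin_cases b <;> simp [pauliX]

omit [Fintype ι] in
theorem flipIf_involutive (t : ι) (p : (ι → Fin 2) → Prop) [DecidablePred p] :
    Function.Involutive (flipIf t p) := by
  intro x
  unfold flipIf
  by_cases h : p (Function.update x t 0)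
  · simp only [h, if_true, Function.update_idem, Function.update_self]
    have : x t + 1 + 1 = x t := by generalize x t = a; fin_cases a <;> rfl
    rw [this, Function.update_eq_self]
  · simp [h]

/-- The operator flipping the qubit `t` if the other qubits satisfy `p` is a permutation matrix. -/
theorem controlled_pauliX_eq (t : ι) (p : (ι → Fin 2) → Prop) [DecidablePred p] :
    controlled t (fun x => if p x then pauliX else 1) =
      (1 : Op ι).submatrix (flipIf t p) id := by
  ext x y
  simp only [controlled, Matrix.of_apply, Matrix.submatrix_apply, id, Matrix.one_apply,
    flipIf]
  by_cases h : p (Function.update x t 0)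
  · simp only [h, if_true, pauliX_apply]
    rw [← ite_and]
    congr 1
    rw [eq_iff_iff]
    constructor
    · rintro ⟨h1, h2⟩
      ext k
      by_cases hk : k = t
      · subst hk; simp [h2]
      · simp [hk, h1 k hk]
    · rintro rfl
      refine ⟨fun k hk => by simp [hk], by simp⟩
  · simp only [h, if_false, Matrix.one_apply]
    rw [← ite_and]
    congr 1
    rw [eq_iff_iff]
    constructor
    · rintro ⟨h1, h2⟩
      ext k
      by_cases hk : k = t
      · subst hk; simp [h2]
      · simp [h1 k hk]
    · rintro rfl
      exact ⟨fun _ _ => rfl, rfl⟩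

theorem one_submatrix_perm_mul (e : (ι → Fin 2) → ι → Fin 2) (M : Op ι) :
    (1 : Op ι).submatrix e id * M = M.submatrix e id := by
  ext x y
  simp [Matrix.mul_apply, Matrix.one_apply]

theorem mul_one_submatrix_perm {e : (ι → Fin 2) → ι → Fin 2} (he : Function.Involutive e)
    (M : Op ι) : M * (1 : Op ι).submatrix e id = M.submatrix id e := by
  ext x y
  simp only [Matrix.mul_apply, Matrix.one_apply, Matrix.submatrix_apply, id, mul_ite, mul_one,
    mul_zero]
  rw [Finset.sum_eq_single (e y)]
  · simp [he y]
  · intro b _ hb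
    rw [if_neg]
    rintro rfl
    exact hb (he b).symm
  · simp

/-- The controlled `X` is the permutation matrix of an involution, so conjugating a diagonal matrix
by it permutes the entries. -/
theorem HasCircuit.flipIf {G : ℕ} {t : ι} {p : (ι → Fin 2) → Prop} [DecidablePred p]
    (h : HasCircuit G (controlled t (fun x => if p x then pauliX else 1))) :
    HasClassicalCircuit G (flipIf t p) := by
  refine ⟨_, h, fun d => ?_⟩
  have hstar : (controlled t (fun x => if p x then pauliX else 1)).conjTranspose =
      controlled t (fun x => if p x then pauliX else 1) := by
    rw [controlled_conjTranspose]
    congr 1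
    ext1 x
    split_ifs
    · exact pauliX_conjTranspose
    · exact Matrix.conjTranspose_one
  rw [hstar, controlled_pauliX_eq, one_submatrix_perm_mul,
    mul_one_submatrix_perm (flipIf_involutive t p), Matrix.submatrix_submatrix]
  exact Matrix.submatrix_diagonal d _ (flipIf_involutive t p).injective

theorem hasCircuit_cnot {a t : ι} (h : a ≠ t) :
    HasCircuit 1 (controlled t (fun x => if x a = 1 then pauliX else 1)) := by
  refine HasCircuit.of_gate
    (isTwoLocal_controlled t a (fun b => if b = 1 then pauliX else 1) h)
    (controlled_mem_unitaryGroup t fun x => ?_)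
  split_ifs
  · rw [pauliX_conjTranspose, pauliX_mul_self]
  · simp

theorem hasClassicalCircuit_not (t : ι) : HasClassicalCircuit 1 (flipIf t fun _ => True) := by
  apply HasCircuit.flipIf
  refine HasCircuit.of_gate (by simpa using isTwoLocal_controlled_const t pauliX)
    (controlled_mem_unitaryGroup t fun x => ?_)
  simp only [if_true]
  rw [pauliX_conjTranspose, pauliX_mul_self]

/-- The doubly controlled `X` gate, with control values `1` and `β`, from five two-local gates. -/
theorem hasClassicalCircuit_toffoli {a b t : ι} (hat : a ≠ t) (hbt : b ≠ t) (hab : a ≠ b)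
    (β : Fin 2) : HasClassicalCircuit 5 (flipIf t fun x => x a = 1 ∧ x b = β) := by
  apply HasCircuit.flipIf
  have hsq : sqrtX.conjTranspose * sqrtX = 1 := mul_eq_one_comm.1 sqrtX_mul_conjTranspose
  have h1 : HasCircuit 1 (controlled t (fun x => if x a = 1 then sqrtX else 1)) := by
    refine HasCircuit.of_gate
      (isTwoLocal_controlled t a (fun b => if b = 1 then sqrtX else 1) hat)
      (controlled_mem_unitaryGroup t fun x => ?_)
    split_ifs
    · exact sqrtX_mul_conjTranspose
    · simp
  have h2 : HasCircuit 1 (controlled t (fun x => if x b = β then sqrtX else 1)) := by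
    refine HasCircuit.of_gate
      (isTwoLocal_controlled t b (fun b => if b = β then sqrtX else 1) hbt)
      (controlled_mem_unitaryGroup t fun x => ?_)
    split_ifs
    · exact sqrtX_mul_conjTranspose
    · simp
  have h3 : HasCircuit 1 (controlled t (fun x => if x b = β then sqrtX.conjTranspose else 1)) := by
    refine HasCircuit.of_gate
      (isTwoLocal_controlled t b (fun b => if b = β then sqrtX.conjTranspose else 1) hbt)
      (controlled_mem_unitaryGroup t fun x => ?_)
    split_ifs
    · rw [Matrix.conjTranspose_conjTranspose, hsq]
    · simp
  have h4 := hasCircuit_cnot hab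
  -- On `t` the exponents of `sqrtX` add up to [a = 1] + [b = β] - [exactly one of the two], which
  -- is 2 [a = 1 and b = β].
  have key : controlled t (fun x => if x a = 1 ∧ x b = β then pauliX else 1) =
      controlled t (fun x => if x a = 1 then sqrtX else 1) *
      (controlled t (fun x => if x b = β then sqrtX else 1) *
      (controlled b (fun x => if x a = 1 then pauliX else 1) *
      (controlled t (fun x => if x b = β then sqrtX.conjTranspose else 1) *
      controlled b (fun x => if x a = 1 then pauliX else 1)))) := by
    -- Conjugation by the CNOT from `a` to `b` replaces the control value `x b` by `x b + [x a =
    -- 1]`; testing it against `β` gives the exclusive or.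
    have hconj : controlled b (fun x => if x a = 1 then pauliX else 1) *
        (controlled t (fun x => if x b = β then sqrtX.conjTranspose else 1) *
        controlled b (fun x => if x a = 1 then pauliX else 1)) =
        controlled t (fun x => if (x b = β ∧ x a ≠ 1) ∨ (x b ≠ β ∧ x a = 1)
          then sqrtX.conjTranspose else 1) := by
      rw [controlled_pauliX_eq, mul_one_submatrix_perm (flipIf_involutive _ _),
        one_submatrix_perm_mul, Matrix.submatrix_submatrix]
      ext x y
      simp only [Matrix.submatrix_apply, Function.comp, id,
        controlled, Matrix.of_apply, Function.update_of_ne hat, Function.update_of_ne hbt]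
      have hb : flipIf b (fun x => x a = 1) x b = if x a = 1 then x b + 1 else x b := by
        unfold flipIf
        simp only [Function.update_of_ne hab]
        split_ifs <;> simp
      have hk : ∀ z k, k ≠ b → flipIf b (fun x => x a = 1) z k = z k := by
        intro z k hk
        unfold flipIf
        split_ifs <;> simp [hk]
      have hby : flipIf b (fun x => x a = 1) y b = if y a = 1 then y b + 1 else y b := by
        unfold flipIf
        simp only [Function.update_of_ne hab]
        split_ifs <;> simp
      have hag : (∀ k, k ≠ t → flipIf b (fun x => x a = 1) x k = flipIf b (fun x => x a = 1) y k) ↔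
          ∀ k, k ≠ t → x k = y k := by
        constructor
        · intro h k hkt
          by_cases hkb : k = b
          · subst hkb
            have h5 := h k hkt
            have h6 := h a hat
            rw [hk _ _ hab, hk _ _ hab] at h6
            rw [hb, hby, h6] at h5
            split_ifs at h5
            · exact add_right_cancel h5
            · exact h5
          · simpa [hk _ _ hkb] using h k hkt
        · intro h k hkt
          by_cases hkb : k = b
          · subst hkb
            rw [hb, hby, h a hat, h k hkt]
          · simpa [hk _ _ hkb] using h k hkt
      simp only [hag, hb, hk _ _ hbt.symm]
      have hiff : ((if x a = 1 then x b + 1 else x b) = β) ↔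
          ((x b = β ∧ x a ≠ 1) ∨ (x b ≠ β ∧ x a = 1)) := by
        generalize x a = u
        generalize x b = v
        clear * -
        revert u v β
        decide
      simp only [hiff]
    rw [hconj, controlled_mul, controlled_mul]
    congr 1
    ext1 x
    by_cases ha : x a = 1 <;> by_cases hb : x b = β <;>
      simp [ha, hb, sqrtX_mul_self, sqrtX_mul_conjTranspose]
  rw [key]
  exact h1.mul (h2.mul (h4.mul (h3.mul h4)))

end Circuits

end CompInfo

namespace CompInfo

/-! ### Finite automata as reversible circuits -/

section Automata

variable {R : Type} [Fintype R] [DecidableEq R] {Q : Type}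

/-- One transition of an automaton, from the one-hot encoded state `w` to the register `w'`. -/
theorem exists_transition_circuit [DecidableEq Q] (i : R) (w w' : Q → R)
    (hww' : ∀ q q', w q ≠ w' q') (hwi : ∀ q, w q ≠ i) (hwi' : ∀ q, w' q ≠ i)
    (δ : Q → Fin 2 → Q) (F : Finset (Q × Fin 2)) :
    ∃ φ : (R → Fin 2) → (R → Fin 2), HasClassicalCircuit (F.card * 5) φ ∧
      ∀ x q₀, (∀ q, x (w q) = if q = q₀ then 1 else 0) →
        φ x = if (q₀, x i) ∈ F then
          Function.update x (w' (δ q₀ (x i))) (x (w' (δ q₀ (x i))) + 1) else x := by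
  induction F using Finset.induction_on with
  | empty => exact ⟨id, by simpa using HasClassicalCircuit.id, by simp⟩
  | insert e F he ih =>
    obtain ⟨φ, hφ, h⟩ := ih
    obtain ⟨q, β⟩ := e
    refine ⟨_, HasClassicalCircuit.mono ?_ ((hasClassicalCircuit_toffoli (hww' q (δ q β))
      (hwi' (δ q β)).symm (hwi q) β).comp hφ), fun x q₀ hx => ?_⟩
    · rw [Finset.card_insert_of_notMem he]; ring_nf; rfl
    -- The gates already placed alter only the qubits `w'`, so both controls still show the original
    -- values. By the one-hot encoding, exactly the gate of the pair `(q₀, x i)` can fire.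
    have hcond : ((φ x) (w q) = 1 ∧ (φ x) i = β) ↔ (q₀, x i) = (q, β) := by
      have h1 : φ x (w q) = x (w q) := by
        rw [h x q₀ hx]
        split_ifs
        · rw [Function.update_of_ne (hww' _ _)]
        · rfl
      have h2 : φ x i = x i := by
        rw [h x q₀ hx]
        split_ifs
        · rw [Function.update_of_ne (hwi' _).symm]
        · rfl
      rw [h1, h2, hx, Prod.mk.injEq]
      by_cases hq : q = q₀
      · simp [hq]
      · simp [hq, Ne.symm hq]
    simp only [Function.comp, flipIf, Function.update_of_ne (hww' q (δ q β)),
      Function.update_of_ne (hwi' (δ q β)).symm, hcond, Finset.mem_insert]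
    by_cases hc : (q₀, x i) = (q, β)
    · have hφx : φ x = x := by
        rw [h x q₀ hx, if_neg]
        rw [hc]
        exact he
      obtain ⟨rfl, rfl⟩ := Prod.mk.inj hc
      rw [if_pos rfl, if_pos (Or.inl rfl), hφx]
    · rw [if_neg hc, h x q₀ hx]
      simp [hc]

/-- The state of an automaton with transitions `δ s` after reading `s` of the qubits `inp`. -/
def runAutomaton (δ : ℕ → Q → Fin 2 → Q) (inp : ℕ → R) (q₀ : Q) (x : R → Fin 2) : ℕ → Q
  | 0 => q₀
  | s + 1 => δ s (runAutomaton δ inp q₀ x s) (x (inp s))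

/-- An automaton run is computed, one-hot encoded, by a reversible circuit. -/
theorem exists_automaton_circuit [Fintype Q] [DecidableEq Q] (N : ℕ) (inp : ℕ → R)
    (w : ℕ → Q → R)
    (hw : ∀ s ≤ N, ∀ s' ≤ N, ∀ q q', w s q = w s' q' → s = s' ∧ q = q')
    (hinp : ∀ s < N, ∀ s' ≤ N, ∀ q, w s' q ≠ inp s)
    (δ : ℕ → Q → Fin 2 → Q) (q₀ : Q) : ∀ s ≤ N,
    ∃ φ : (R → Fin 2) → (R → Fin 2),
      HasClassicalCircuit (1 + s * (Fintype.card Q * 10)) φ ∧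
      ∀ x, (∀ s' ≤ N, ∀ q, x (w s' q) = 0) →
        (∀ s' < N, φ x (inp s') = x (inp s')) ∧
        (∀ q, φ x (w s q) = if q = runAutomaton δ inp q₀ x s then 1 else 0) ∧
        ∀ s', s < s' → s' ≤ N → ∀ q, φ x (w s' q) = 0 := by
  intro s
  induction s with
  | zero =>
    intro _
    -- A single NOT prepares the one-hot code of the initial state; it is the summand `1` in the
    -- gate count.
    refine ⟨_, by simpa using hasClassicalCircuit_not (w 0 q₀), fun x hx => ⟨?_, ?_, ?_⟩⟩
    · intro s' hs'
      simp [flipIf, Function.update_of_ne (hinp s' hs' 0 (Nat.zero_le _) q₀).symm]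
    · intro q
      simp only [flipIf, if_true, runAutomaton]
      by_cases hq : q = q₀
      · subst hq
        simp [hx 0 (Nat.zero_le _) q]
      · have : w 0 q ≠ w 0 q₀ := fun h => hq (hw 0 (Nat.zero_le _) 0 (Nat.zero_le _) _ _ h).2
        simp [hq, Function.update_of_ne this, hx 0 (Nat.zero_le _) q]
    · intro s' h1 h2 q
      have : w s' q ≠ w 0 q₀ := fun h => h1.ne (hw s' h2 0 (Nat.zero_le _) _ _ h).1.symm
      simp [flipIf, Function.update_of_ne this, hx s' h2 q]
  | succ s ih =>
    intro hs
    obtain ⟨φ, hφ, h⟩ := ih (by omega)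
    obtain ⟨ψ, hψ, h'⟩ := exists_transition_circuit (inp s) (w s) (w (s + 1))
      (fun q q' e => by have := (hw s (by omega) (s + 1) hs _ _ e).1; omega)
      (hinp s (by omega) s (by omega)) (hinp s (by omega) (s + 1) hs) (δ s) Finset.univ
    refine ⟨_, HasClassicalCircuit.mono ?_ (hψ.comp hφ), fun x hx => ?_⟩
    · simp only [Finset.card_univ, Fintype.card_prod, Fintype.card_fin]
      apply le_of_eq
      ring
    obtain ⟨g1, g2, g3⟩ := h x hx
    have hval := h' (φ x) _ g2
    -- The register of time `s + 1` is still all zero, so the flip writes a `1` at the new state and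
    -- yields its one-hot code.
    rw [if_pos (Finset.mem_univ _), g3 (s + 1) (by omega) hs, g1 s (by omega)] at hval
    simp only [Function.comp, hval]
    refine ⟨fun s' hs' => ?_, fun q => ?_, fun s' h1 h2 q => ?_⟩
    · rw [Function.update_of_ne (hinp s' hs' _ hs _).symm, g1 s' hs']
    · rw [runAutomaton]
      by_cases hq : q = δ s (runAutomaton δ inp q₀ x s) (x (inp s))
      · rw [← hq]; simp
      · rw [Function.update_of_ne fun e => hq (hw _ hs _ hs _ _ e).2,
          g3 (s + 1) (by omega) hs, if_neg hq]
    · rw [Function.update_of_ne fun e => h1.ne (hw _ h2 _ hs _ _ e).1.symm,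
        g3 s' (by omega) h2]

end Automata

end CompInfo

namespace CompInfo

/-! ### Effects measuring a set of qubits -/

section Effects

variable {ι : Type} [Fintype ι] [DecidableEq ι]

/-- The indicator function of the event that all qubits in `S` are `0`. -/
def zeroOn (S : Finset ι) (z : ι → Fin 2) : ℂ := if ∀ i ∈ S, z i = 0 then 1 else 0

theorem tensorOp_eq_diagonal (S : Finset ι) :
    tensorOp (fun i => if i ∈ S then ketbraZero else 1) = Matrix.diagonal (zeroOn S) := by
  ext x y
  simp only [tensorOp, Matrix.of_apply, Matrix.diagonal_apply, zeroOn]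
  have hentry : ∀ i, (if i ∈ S then ketbraZero else 1 : Matrix (Fin 2) (Fin 2) ℂ) (x i) (y i) =
      if x i = y i ∧ (i ∈ S → x i = 0) then 1 else 0 := by
    intro i
    generalize x i = u
    generalize y i = v
    by_cases hi : i ∈ S <;> fin_cases u <;> fin_cases v <;>
      simp [hi, ketbraZero]
  simp only [hentry]
  by_cases hxy : x = y
  · subst hxy
    by_cases hS : ∀ i ∈ S, x i = 0
    · rw [if_pos rfl, if_pos hS]
      exact Finset.prod_eq_one fun i _ => if_pos ⟨rfl, hS i⟩
    · rw [if_pos rfl, if_neg hS]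
      push Not at hS
      obtain ⟨i, hi, h⟩ := hS
      exact Finset.prod_eq_zero (Finset.mem_univ i) (if_neg fun h' => h (h'.2 hi))
  · rw [if_neg hxy]
    obtain ⟨i, hi⟩ := Function.ne_iff.1 hxy
    exact Finset.prod_eq_zero (Finset.mem_univ i) (if_neg fun h' => hi h'.1)

theorem conj_diagonal_apply (U : Op ι) (d : (ι → Fin 2) → ℂ) (x y : ι → Fin 2) :
    (U * Matrix.diagonal d * U.conjTranspose) x y = ∑ z, U x z * d z * star (U y z) := by
  rw [Matrix.mul_apply]
  simp only [Matrix.mul_diagonal, Matrix.conjTranspose_apply]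

/-- A circuit of `G` gates acts trivially outside a set of at most `2 G` qubits. -/
theorem HasCircuit.exists_support {G : ℕ} {U : Op ι} (h : HasCircuit G U) :
    ∃ T : Finset ι, T.card ≤ 2 * G ∧ ∀ x z, U x z ≠ 0 → ∀ i ∉ T, x i = z i := by
  obtain ⟨L, h1, h2, rfl⟩ := h
  suffices H : ∃ T : Finset ι, T.card ≤ 2 * L.length ∧
      ∀ x z, L.prod x z ≠ 0 → ∀ i ∉ T, x i = z i by
    obtain ⟨T, hT, h⟩ := H
    exact ⟨T, by omega, h⟩
  clear h2
  induction L with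
  | nil =>
    refine ⟨∅, by simp, fun x z hxz i _ => ?_⟩
    rw [List.prod_nil, Matrix.one_apply] at hxz
    by_contra hne
    exact hxz (if_neg fun e => hne (by rw [e]))
  | cons g L ih =>
    obtain ⟨T, hT, h⟩ := ih fun g' hg' => h1 g' (List.mem_cons_of_mem _ hg')
    obtain ⟨i, j, V, hV⟩ := (h1 g List.mem_cons_self).1
    refine ⟨insert i (insert j T), ?_, fun x z hxz k hk => ?_⟩
    · have e1 := Finset.card_insert_le i (insert j T)
      have e2 := Finset.card_insert_le j T
      rw [List.length_cons]
      omega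
    · simp only [Finset.mem_insert, not_or] at hk
      rw [List.prod_cons, Matrix.mul_apply] at hxz
      obtain ⟨y, -, hy⟩ := Finset.exists_ne_zero_of_sum_ne_zero hxz
      have hg : ∀ k, k ≠ i → k ≠ j → x k = y k := by
        by_contra hc
        apply left_ne_zero_of_mul hy
        rw [hV, if_neg hc]
      rw [hg k hk.1 hk.2.1, h y z (right_ne_zero_of_mul hy) k hk.2.2]

/-- Every effect is a measurement of few qubits after a circuit. -/
theorem exists_of_mem_effects {G : ℕ} {Λ : Op ι} (h : Λ ∈ effects ι G) :
    ∃ (a : ℕ) (U : Op (ι ⊕ Fin a)) (S : Finset (ι ⊕ Fin a)), HasCircuit G U ∧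
      S.card ≤ Fintype.card ι + 2 * G ∧
      Λ = ancZero (U * Matrix.diagonal (zeroOn S) * U.conjTranspose) := by
  classical
  obtain ⟨a, U, A, hU, hA, rfl⟩ := h
  rw [gateComplexity_le_iff] at hU
  obtain ⟨T, hT, hsupp⟩ := hU.exists_support
  let S₀ := Finset.univ.filter fun i => A i = ketbraZero
  have hA' : A = fun i => if i ∈ S₀ then ketbraZero else 1 := by
    ext1 i
    simp only [S₀, Finset.mem_filter, Finset.mem_univ, true_and]
    split_ifs with h
    · exact h
    · exact (hA i).resolve_left h
  -- Only input qubits and qubits touched by the circuit need to be measured: any other ancilla is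
  -- still `0` and passes the test automatically. This bounds the number of measured qubits
  -- independently of the number of ancillas.
  let S := S₀.filter fun i => i ∈ Finset.univ.map Function.Embedding.inl ∪ T
  refine ⟨a, U, S, hU, ?_, ?_⟩
  · calc S.card ≤ (Finset.univ.map Function.Embedding.inl ∪ T).card :=
          Finset.card_le_card fun i hi => (Finset.mem_filter.1 hi).2
      _ ≤ _ := (Finset.card_union_le _ _).trans (by simpa using hT)
  · rw [hA', tensorOp_eq_diagonal]
    ext x y
    simp only [ancZero, Matrix.of_apply, conj_diagonal_apply]
    refine Finset.sum_congr rfl fun z _ => ?_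
    by_cases hz : (U : Op (ι ⊕ Fin a)) (Sum.elim x fun _ => 0) z = 0
    · rw [hz]; simp
    congr 2
    unfold zeroOn
    congr 1
    rw [eq_iff_iff]
    refine ⟨fun h i hi => h i (Finset.mem_filter.1 hi).1, fun h i hi => ?_⟩
    by_cases hi' : i ∈ Finset.univ.map Function.Embedding.inl ∪ T
    · exact h i (Finset.mem_filter.2 ⟨hi, hi'⟩)
    · rw [Finset.mem_union, not_or] at hi'
      rw [← hsupp _ _ hz i hi'.2]
      rcases i with i | i
      · exact absurd (by simp) hi'.1
      · rfl

theorem effects_mono {G G' : ℕ} (h : G ≤ G') : effects ι G ⊆ effects ι G' := by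
  rintro Λ ⟨a, U, A, hU, hA, rfl⟩
  exact ⟨a, U, A, hU.trans (by exact_mod_cast h), hA, rfl⟩

/-- Circuits on a register that is identified with `ι` and ancilla qubits give effects. -/
theorem mem_effects_of_hasCircuit {α R : Type} [Fintype α] [Fintype R] [DecidableEq R]
    (e : ι ⊕ α ≃ R) {G : ℕ} {C : Op R} (hC : HasCircuit G C) (S : Finset R) :
    (Matrix.of fun x y : ι → Fin 2 =>
      (C * Matrix.diagonal (zeroOn S) * C.conjTranspose)
        (fun r => Sum.elim x (fun _ => 0) (e.symm r))
        (fun r => Sum.elim y (fun _ => 0) (e.symm r))) ∈ effects ι G := by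
  let f : R ≃ ι ⊕ Fin (Fintype.card α) :=
    e.symm.trans (Equiv.sumCongr (Equiv.refl _) (Fintype.equivFin α))
  let F : (R → Fin 2) ≃ (ι ⊕ Fin (Fintype.card α) → Fin 2) := Equiv.arrowCongr f (Equiv.refl _)
  have hF : ∀ x i, F.symm x i = x (f i) := fun x i => rfl
  have hcirc : HasCircuit G (Matrix.reindexAlgEquiv ℂ ℂ F C) := by
    refine HasCircuit.map (Matrix.reindexAlgEquiv ℂ ℂ F : Op R →* Op (ι ⊕ Fin (Fintype.card α)))
      ?_ hC
    intro g hg hu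
    constructor
    · obtain ⟨i, j, V, hV⟩ := hg
      refine ⟨f i, f j, V, fun x y => ?_⟩
      change g (F.symm x) (F.symm y) = _
      rw [hV]
      simp only [hF]
      congr 1
      rw [eq_iff_iff]
      constructor
      · intro h k hki hkj
        have := h (f.symm k) (fun e => hki (by rw [← e]; simp)) (fun e => hkj (by rw [← e]; simp))
        simpa using this
      · intro h k hki hkj
        exact h (f k) (fun e => hki (f.injective e)) (fun e => hkj (f.injective e))
    · rw [Matrix.mem_unitaryGroup_iff] at hu ⊢
      change Matrix.reindexAlgEquiv ℂ ℂ F g * Matrix.reindexAlgEquiv ℂ ℂ F (star g) = 1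
      rw [← map_mul, hu, map_one]
  refine ⟨Fintype.card α, ⟨_, hcirc.mem_unitaryGroup⟩,
    fun i => if i ∈ S.map f.toEmbedding then ketbraZero else 1,
    (gateComplexity_le_iff _ _).2 hcirc, fun i => ?_, ?_⟩
  · dsimp only
    split_ifs
    · exact Or.inl rfl
    · exact Or.inr rfl
  · rw [tensorOp_eq_diagonal]
    ext x y
    simp only [ancZero, Matrix.of_apply, conj_diagonal_apply]
    refine Fintype.sum_equiv F _ _ fun z => ?_
    have hx : ∀ x : ι → Fin 2, F.symm (Sum.elim x fun _ => 0) =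
        fun r => Sum.elim x (fun _ => 0) (e.symm r) := by
      intro x
      ext1 r
      rw [hF]
      simp only [f, Equiv.trans_apply]
      rcases e.symm r with i | i <;> rfl
    simp only [Matrix.coe_reindexAlgEquiv, Matrix.reindex_apply, Matrix.submatrix_apply,
      Equiv.symm_apply_apply, hx]
    congr 2
    unfold zeroOn
    congr 1
    rw [eq_iff_iff]
    simp only [Finset.mem_map, Equiv.coe_toEmbedding, forall_exists_index, and_imp,
      forall_apply_eq_imp_iff₂]
    have hz : ∀ r, F z (f r) = z r := by
      intro r
      rw [← hF (F z), Equiv.symm_apply_apply]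
    simp only [hz]

theorem one_mem_effects : (1 : Op ι) ∈ effects ι 0 := by
  convert mem_effects_of_hasCircuit (α := Fin 0) (Equiv.refl (ι ⊕ Fin 0)) HasCircuit.one ∅ using 1
  have : Matrix.diagonal (zeroOn (∅ : Finset (ι ⊕ Fin 0))) = 1 := by
    rw [← Matrix.diagonal_one]
    congr 1
    ext z
    simp [zeroOn]
  rw [this]
  ext x y
  simp only [Matrix.conjTranspose_one, mul_one, Matrix.of_apply, Matrix.one_apply]
  congr 1
  rw [eq_iff_iff]
  constructor
  · rintro rfl; rfl
  · intro h
    ext1 i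
    exact congrFun h (Sum.inl i)

end Effects

/-! ### Applying operators to the copies of a register -/

section Copies

variable {κ Y : Type} [Fintype κ] [DecidableEq κ] [Fintype Y] [DecidableEq Y] {m : ℕ}

/-- The qubits of copy `c`. -/
def slice (x : (Fin m × κ) ⊕ Y → Fin 2) (c : Fin m) : κ → Fin 2 := fun k => x (Sum.inl (c, k))

/-- The assignment of values to all qubits of `m` copies of a register, and of a further one. -/
def joinSlices : (Fin m → κ → Fin 2) × (Y → Fin 2) ≃ ((Fin m × κ) ⊕ Y → Fin 2) where
  toFun p := Sum.elim (fun r => p.1 r.1 r.2) p.2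
  invFun x := (slice x, fun r => x (Sum.inr r))
  left_inv p := rfl
  right_inv x := by
    ext r
    rcases r with r | r <;> rfl

/-- `M c` acts on copy `c`, for all `c`. -/
def onCopies (Y : Type) [Fintype Y] [DecidableEq Y] (M : Fin m → Op κ) : Op ((Fin m × κ) ⊕ Y) :=
  Matrix.of fun x y =>
    if (fun r => x (Sum.inr r)) = (fun r => y (Sum.inr r)) then
      ∏ c, M c (slice x c) (slice y c) else 0

omit [Fintype κ] [DecidableEq κ] in
theorem onCopies_joinSlices_right (M : Fin m → Op κ) (x : (Fin m × κ) ⊕ Y → Fin 2)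
    (zs : Fin m → κ → Fin 2) (l : Y → Fin 2) :
    onCopies Y M x (joinSlices (zs, l)) =
      if (fun r => x (Sum.inr r)) = l then ∏ c, M c (slice x c) (zs c) else 0 := rfl

omit [Fintype κ] [DecidableEq κ] in
theorem onCopies_joinSlices_left (M : Fin m → Op κ) (y : (Fin m × κ) ⊕ Y → Fin 2)
    (zs : Fin m → κ → Fin 2) (l : Y → Fin 2) :
    onCopies Y M (joinSlices (zs, l)) y =
      if l = (fun r => y (Sum.inr r)) then ∏ c, M c (zs c) (slice y c) else 0 := rfl

/-- The sum over intermediate assignments factorises into one sum per copy, by distributivity; the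
values on `Y` are fixed. -/
theorem onCopies_mul (M N : Fin m → Op κ) :
    onCopies Y M * onCopies Y N = onCopies Y (M * N) := by
  ext x y
  rw [Matrix.mul_apply, ← joinSlices.sum_comp, Fintype.sum_prod_type]
  simp only [onCopies_joinSlices_right, onCopies_joinSlices_left, ite_mul, zero_mul, mul_ite,
    mul_zero, Finset.sum_ite_eq', Finset.mem_univ, if_true]
  simp only [onCopies, Matrix.of_apply, Pi.mul_apply, Matrix.mul_apply]
  split_ifs
  · rw [Fintype.prod_sum]
    simp only [Finset.prod_mul_distrib]
  · simp

omit [DecidableEq κ] in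
theorem onCopies_one : onCopies Y (1 : Fin m → Op κ) = 1 := by
  ext x y
  simp only [onCopies, Matrix.of_apply, Pi.one_apply, Matrix.one_apply]
  by_cases hxy : x = y
  · subst hxy; simp
  · rw [if_neg hxy]
    split_ifs with h
    · have : ∃ c, slice x c ≠ slice y c := by
        by_contra hc
        push Not at hc
        exact hxy (joinSlices.symm.injective (Prod.ext (funext hc) h))
      obtain ⟨c, hc⟩ := this
      exact Finset.prod_eq_zero (Finset.mem_univ c) (if_neg hc)
    · rfl

omit [Fintype κ] [DecidableEq κ] in
theorem onCopies_conjTranspose (M : Fin m → Op κ) :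
    (onCopies Y M).conjTranspose = onCopies Y fun c => (M c).conjTranspose := by
  ext x y
  simp only [onCopies, Matrix.of_apply, Matrix.conjTranspose_apply]
  by_cases h : (fun r => x (Sum.inr r)) = (fun r => y (Sum.inr r))
  · simp [h]
  · rw [if_neg h, if_neg (Ne.symm h), star_zero]

/-- The operator acting on the copy `c` only. -/
def onCopy (Y : Type) [Fintype Y] [DecidableEq Y] (c : Fin m) : Op κ →* Op ((Fin m × κ) ⊕ Y) where
  toFun g := onCopies Y (Pi.mulSingle c g)
  map_one' := by rw [Pi.mulSingle_one, onCopies_one]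
  map_mul' g h := by rw [onCopies_mul, Pi.mulSingle_mul]

theorem isTwoLocal_onCopy (c : Fin m) {g : Op κ} (hg : IsTwoLocal g) :
    IsTwoLocal (onCopy Y c g) := by
  obtain ⟨i, j, V, hV⟩ := hg
  refine ⟨Sum.inl (c, i), Sum.inl (c, j), V, fun x y => ?_⟩
  change onCopies Y (Pi.mulSingle c g) x y = _
  simp only [onCopies, Matrix.of_apply]
  rw [← Finset.mul_prod_erase _ _ (Finset.mem_univ c), Pi.mulSingle_eq_same, hV]
  have hrest : ∏ c' ∈ Finset.univ.erase c,
      (Pi.mulSingle c g : Fin m → Op κ) c' (slice x c') (slice y c') =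
      if ∀ c', c' ≠ c → slice x c' = slice y c' then 1 else 0 := by
    split_ifs with h
    · refine Finset.prod_eq_one fun c' hc' => ?_
      have hc := Finset.ne_of_mem_erase hc'
      rw [Pi.mulSingle_eq_of_ne hc, h c' hc, Matrix.one_apply_eq]
    · push Not at h
      obtain ⟨c', hc, h⟩ := h
      refine Finset.prod_eq_zero (Finset.mem_erase.2 ⟨hc, Finset.mem_univ _⟩) ?_
      rw [Pi.mulSingle_eq_of_ne hc, Matrix.one_apply_ne h]
  rw [hrest]
  by_cases hall : ∀ k, k ≠ Sum.inl (c, i) → k ≠ Sum.inl (c, j) → x k = y k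
  · rw [if_pos hall, if_pos (funext fun r => hall _ (by simp) (by simp)), if_pos, if_pos]
    · simp [slice]
    · exact fun c' hc' => funext fun k => hall _ (by simp [hc']) (by simp [hc'])
    · exact fun k hi hj => hall _ (by simp [hi]) (by simp [hj])
  · rw [if_neg hall]
    split_ifs with h1 h2 h3
    · refine absurd (fun k hi hj => ?_) hall
      rcases k with ⟨c', k⟩ | r
      · by_cases hc : c' = c
        · subst hc
          exact h2 k (fun e => hi (by rw [e])) (fun e => hj (by rw [e]))
        · exact congrFun (h3 c' hc) k
      · exact congrFun h1 r
    all_goals simp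

theorem onCopy_mem_unitaryGroup (c : Fin m) {g : Op κ}
    (hg : g ∈ Matrix.unitaryGroup (κ → Fin 2) ℂ) :
    onCopy Y c g ∈ Matrix.unitaryGroup ((Fin m × κ) ⊕ Y → Fin 2) ℂ := by
  rw [Matrix.mem_unitaryGroup_iff, Matrix.star_eq_conjTranspose] at hg ⊢
  change onCopies Y (Pi.mulSingle c g) * (onCopies Y (Pi.mulSingle c g)).conjTranspose = 1
  rw [onCopies_conjTranspose, onCopies_mul, ← onCopies_one]
  congr 1
  ext1 c'
  rw [Pi.mul_apply]
  by_cases h : c' = c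
  · subst h
    simpa using hg
  · simp [Pi.mulSingle_eq_of_ne h]

/-- The copies are treated one after another: each factor is the circuit of `U` transported gate by
gate to one copy. -/
theorem hasCircuit_onCopies {G : ℕ} {U : Op κ} (hU : HasCircuit G U) :
    HasCircuit (m * G) (onCopies Y fun _ : Fin m => U) := by
  have key : ∀ s : Finset (Fin m),
      HasCircuit (s.card * G) (onCopies Y fun c => if c ∈ s then U else 1) := by
    intro s
    induction s using Finset.induction_on with
    | empty =>
      simp only [Finset.notMem_empty, if_false, Finset.card_empty, zero_mul]
      rw [show (fun _ : Fin m => (1 : Op κ)) = 1 from rfl, onCopies_one]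
      exact HasCircuit.one
    | insert c s hc ih =>
      have h1 : HasCircuit G (onCopy Y c U) :=
        hU.map _ fun g hg hu => ⟨isTwoLocal_onCopy c hg, onCopy_mem_unitaryGroup c hu⟩
      have h2 := h1.mul ih
      have h3 : onCopy Y c U * onCopies Y (fun c => if c ∈ s then U else 1) =
          onCopies Y fun c' => if c' ∈ insert c s then U else 1 := by
        change onCopies Y (Pi.mulSingle c U) * _ = _
        rw [onCopies_mul]
        congr 1
        ext1 c'
        rw [Pi.mul_apply]
        by_cases h : c' = c
        · subst h
          simp [hc]
        · simp [h]
      rw [h3] at h2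
      refine h2.mono (le_of_eq ?_)
      rw [Finset.card_insert_of_notMem hc]
      ring
  simpa using key Finset.univ

end Copies

end CompInfo

namespace CompInfo

/-! ### Outcome distributions -/

section Outcomes

variable {ι α : Type} [Fintype ι] [DecidableEq ι] [Fintype α] [DecidableEq α]

/-- The input `x` of a circuit, together with ancilla qubits in the state `0`. -/
def padZero (α : Type) (x : ι → Fin 2) : ι ⊕ α → Fin 2 := Sum.elim x fun _ => 0

/-- The probability of the outcome `z` when all qubits are measured after applying `U†` to `ρ` and
ancilla qubits, as a complex number. -/
noncomputable def outcomeAmp (U : Op (ι ⊕ α)) (ρ : Op ι) (z : ι ⊕ α → Fin 2) : ℂ :=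
  ∑ x, ∑ y, U (padZero α x) z * star (U (padZero α y) z) * ρ y x

-- For fixed `z` this is the quadratic form of `ρ` at the vector formed by the column `z` of `U`,
-- restricted to padded inputs.
omit [Fintype α] [DecidableEq α] in
theorem outcomeAmp_nonneg (U : Op (ι ⊕ α)) {ρ : Op ι} (hρ : ρ.PosSemidef) (z : ι ⊕ α → Fin 2) :
    0 ≤ outcomeAmp U ρ z := by
  have h := hρ.dotProduct_mulVec_nonneg fun x => U (padZero α x) z
  convert h using 1
  simp only [outcomeAmp, dotProduct, Matrix.mulVec, Pi.star_apply, Finset.mul_sum]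
  rw [Finset.sum_comm]
  exact Finset.sum_congr rfl fun y _ => Finset.sum_congr rfl fun x _ => by ring

omit [Fintype α] [DecidableEq α] in
theorem outcomeAmp_eq_ofReal (U : Op (ι ⊕ α)) {ρ : Op ι} (hρ : ρ.PosSemidef)
    (z : ι ⊕ α → Fin 2) : outcomeAmp U ρ z = ((outcomeAmp U ρ z).re : ℂ) :=
  Complex.ext rfl (by simpa using ((Complex.le_def.1 (outcomeAmp_nonneg U hρ z)).2).symm)

/-- This is the passage from quantum to classical: after the circuit only a diagonal observable is
measured, so its expectation is an average over the outcome distribution. -/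
theorem trace_conj_diagonal_mul (U : Op (ι ⊕ α)) (d : (ι ⊕ α → Fin 2) → ℂ) (ρ : Op ι) :
    ((Matrix.of fun x y : ι → Fin 2 =>
      (U * Matrix.diagonal d * U.conjTranspose) (padZero α x) (padZero α y)) * ρ).trace =
    ∑ z, d z * outcomeAmp U ρ z := by
  simp only [Matrix.trace, Matrix.diag_apply, Matrix.mul_apply (M := Matrix.of _), Matrix.of_apply,
    conj_diagonal_apply, outcomeAmp, Finset.mul_sum, Finset.sum_mul]
  rw [Finset.sum_comm' (t' := Finset.univ) (s' := fun _ => Finset.univ) (by simp),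
    Finset.sum_congr rfl fun y _ => Finset.sum_comm, Finset.sum_comm]
  refine Finset.sum_congr rfl fun z _ => ?_
  rw [Finset.sum_comm]
  exact Finset.sum_congr rfl fun x _ => Finset.sum_congr rfl fun y _ => by ring

theorem sum_outcomeAmp {U : Op (ι ⊕ α)} (hU : U ∈ Matrix.unitaryGroup (ι ⊕ α → Fin 2) ℂ)
    {ρ : Op ι} (hρ : ρ.trace = 1) : ∑ z, outcomeAmp U ρ z = 1 := by
  have h := trace_conj_diagonal_mul U (fun _ => 1) ρ
  rw [Matrix.mem_unitaryGroup_iff, Matrix.star_eq_conjTranspose] at hU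
  simp only [one_mul, Matrix.diagonal_one, mul_one, hU] at h
  rw [← h, ← hρ]
  congr 1
  have : (Matrix.of fun x y : ι → Fin 2 =>
      (1 : Op (ι ⊕ α)) (padZero α x) (padZero α y)) = 1 := by
    ext x y
    simp only [Matrix.of_apply, Matrix.one_apply]
    congr 1
    rw [eq_iff_iff]
    exact ⟨fun e => funext fun i => congrFun e (Sum.inl i), fun e => by rw [e]⟩
  rw [this, one_mul]

end Outcomes

/-! ### Counting the copies on which a test fails -/

section Counting

variable {m : ℕ}

/-- The transition of the automaton which counts the copies with a nonzero qubit.  Its state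
consists of this number and of the last such copy. -/
def countStep (c : Fin m) (q : Fin (m + 1) × WithBot (Fin m)) (b : Fin 2) :
    Fin (m + 1) × WithBot (Fin m) :=
  if b = 0 ∨ q.2 = c then q else (Fin.ofNat (m + 1) (q.1 + 1), c)

/-- A copy must be counted once, however many of its qubits are nonzero. As the copies are read in
increasing order, the current copy has been counted already if and only if it is the last one
counted, so remembering that one suffices. -/
theorem runAutomaton_countStep {R : Type} (inp : ℕ → R) (copy : ℕ → Fin m) (N : ℕ)
    (hcopy : ∀ s s', s ≤ s' → s' < N → copy s ≤ copy s') (x : R → Fin 2) : ∀ s ≤ N,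
    runAutomaton (fun s => countStep (copy s)) inp (0, ⊥) x s =
      (Fin.ofNat (m + 1) (((Finset.range s).filter fun s' => x (inp s') ≠ 0).image copy).card,
        (((Finset.range s).filter fun s' => x (inp s') ≠ 0).image copy).max) := by
  intro s
  induction s with
  | zero => intro _; rfl
  | succ s ih =>
    intro hs
    rw [runAutomaton, ih (by omega), Finset.range_add_one, Finset.filter_insert]
    set B := ((Finset.range s).filter fun s' => x (inp s') ≠ 0).image copy with hB
    have hle : ∀ c ∈ B, c ≤ copy s := by
      intro c hc
      obtain ⟨s', hs', rfl⟩ := Finset.mem_image.1 hc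
      have := Finset.mem_range.1 (Finset.mem_filter.1 hs').1
      exact hcopy s' s this.le (by omega)
    by_cases hb : x (inp s) = 0
    · simp [countStep, hb, ← hB]
    · rw [if_pos hb, Finset.image_insert, ← hB]
      by_cases hc : copy s ∈ B
      · have hmax : B.max = (copy s : WithBot (Fin m)) := by
          refine le_antisymm (Finset.max_le fun c hc' => ?_) (Finset.le_max hc)
          exact WithBot.coe_le_coe.2 (hle c hc')
        rw [Finset.insert_eq_of_mem hc, countStep, if_pos (Or.inr hmax)]
      · have hmax : B.max ≠ (copy s : WithBot (Fin m)) := fun h => hc (Finset.mem_of_max h)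
        have hlt : B.card < m + 1 := by
          have := Finset.card_le_univ B
          rw [Fintype.card_fin] at this
          omega
        rw [countStep, if_neg (by simp [hb, hmax]), Finset.card_insert_of_notMem hc,
          Finset.max_insert]
        refine Prod.ext ?_ ?_
        · simp [Nat.mod_eq_of_lt hlt]
        · refine (max_eq_left (Finset.max_le fun c hc' => ?_)).symm
          exact WithBot.coe_le_coe.2 (hle c hc')

end Counting

/-- The counting circuit on `m` copies of a register `κ`: measuring a subset of its output qubits
tells if at least `τ` copies have only zeros on `S`. -/
theorem exists_threshold_circuit {κ : Type} [Fintype κ] [DecidableEq κ] (S : Finset κ) (m : ℕ)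
    (τ : ℝ) : ∃ (Y : Type) (_ : Fintype Y) (_ : DecidableEq Y)
      (φ : ((Fin m × κ) ⊕ Y → Fin 2) → ((Fin m × κ) ⊕ Y → Fin 2))
      (F : Finset ((Fin m × κ) ⊕ Y)),
      HasClassicalCircuit (1 + m * S.card * ((m + 1) * (m + 1) * 10)) φ ∧
      ∀ zs : Fin m → κ → Fin 2, zeroOn F (φ (joinSlices (zs, fun _ => 0))) =
        if τ ≤ ((Finset.univ.filter fun c => ∀ i ∈ S, zs c i = 0).card : ℝ) then 1 else 0 := by
  classical
  let N := m * S.card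
  let Q := Fin (m + 1) × WithBot (Fin m)
  let Y := Fin (N + 1) × Q
  let R := (Fin m × κ) ⊕ Y
  let q₀ : Q := (0, ⊥)
  let w : ℕ → Q → R := fun s q => Sum.inr (Fin.ofNat (N + 1) s, q)
  let idx : (s : ℕ) → s < N → Fin m × Fin S.card := fun s h => finProdFinEquiv.symm ⟨s, h⟩
  let inp : ℕ → R := fun s => if h : s < N then
    Sum.inl ((idx s h).1, (S.equivFin.symm (idx s h).2 : κ)) else Sum.inr (0, q₀)
  have hw : ∀ s ≤ N, ∀ s' ≤ N, ∀ q q', w s q = w s' q' → s = s' ∧ q = q' := by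
    intro s hs s' hs' q q' h
    have h1 := Prod.mk.inj (Sum.inr_injective h)
    refine ⟨?_, h1.2⟩
    have h2 := congrArg Fin.val h1.1
    rwa [Fin.val_ofNat, Fin.val_ofNat, Nat.mod_eq_of_lt (by omega),
      Nat.mod_eq_of_lt (by omega)] at h2
  have hinp : ∀ s < N, ∀ s' ≤ N, ∀ q, w s' q ≠ inp s := by
    intro s hs s' _ q
    simp [w, inp, hs]
  -- Without copies the answer is the constant `τ ≤ 0`: either nothing is measured, or a qubit just
  -- flipped to `1` is.
  rcases Nat.eq_zero_or_pos m with hm | hm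
  · subst hm
    by_cases hτ : τ ≤ 0
    · refine ⟨Y, inferInstance, inferInstance, id, ∅,
        HasClassicalCircuit.id.mono (Nat.zero_le _), fun zs => ?_⟩
      simp [zeroOn, hτ]
    · refine ⟨Y, inferInstance, inferInstance, _, {Sum.inr (0, q₀)},
        (hasClassicalCircuit_not (Sum.inr (0, q₀))).mono (by omega), fun zs => ?_⟩
      have h0 : joinSlices (zs, fun _ : Y => (0 : Fin 2)) (Sum.inr (0, q₀)) = 0 := rfl
      simp [zeroOn, hτ, flipIf, h0]
  let copy : ℕ → Fin m := fun s => if h : s < N then (idx s h).1 else ⟨0, hm⟩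
  have hcopy : ∀ s s', s ≤ s' → s' < N → copy s ≤ copy s' := by
    intro s s' h h'
    have h1 : s < N := by omega
    simp only [copy, h1, h', dif_pos]
    rw [Fin.le_def]
    exact Nat.div_le_div_right h
  obtain ⟨φ, hφ, h⟩ := exists_automaton_circuit N inp w hw hinp (fun s => countStep (copy s)) q₀
    N le_rfl
  -- The measured qubits are those encoding rejecting final states; by the one-hot code they all
  -- vanish exactly if the final state accepts.
  refine ⟨Y, inferInstance, inferInstance, φ,
    (Finset.univ.filter fun q : Q => ¬ τ ≤ (m : ℝ) - (q.1 : ℕ)).image (w N), ?_, fun zs => ?_⟩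
  · refine hφ.mono (le_of_eq ?_)
    have : Fintype.card (WithBot (Fin m)) = m + 1 := by
      have := Fintype.card_option (α := Fin m)
      rw [Fintype.card_fin] at this
      rw [← this]
      exact Fintype.card_congr (Equiv.refl _)
    simp only [Q, Fintype.card_prod, Fintype.card_fin, this, N]
  · set x := joinSlices (zs, fun _ : Y => (0 : Fin 2)) with hx
    obtain ⟨-, h2, -⟩ := h x fun s' _ q => rfl
    have himg : ((Finset.range N).filter fun s' => x (inp s') ≠ 0).image copy =
        Finset.univ.filter fun c => ¬ ∀ i ∈ S, zs c i = 0 := by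
      ext c
      simp only [Finset.mem_image, Finset.mem_filter, Finset.mem_range, Finset.mem_univ, true_and]
      constructor
      · rintro ⟨s, ⟨hs, hxs⟩, rfl⟩ hall
        apply hxs
        simp only [inp, copy, hs, dif_pos] at hall ⊢
        exact hall _ (S.equivFin.symm (idx s hs).2).2
      · intro hc
        push Not at hc
        obtain ⟨i, hi, hne⟩ := hc
        let s := finProdFinEquiv (c, S.equivFin ⟨i, hi⟩)
        have hidx : idx s s.2 = (c, S.equivFin ⟨i, hi⟩) := finProdFinEquiv.symm_apply_apply _
        refine ⟨s, ⟨s.2, ?_⟩, ?_⟩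
        · have hinps : inp s = Sum.inl (c, i) := by
            simp only [inp]
            rw [dif_pos s.2, hidx, Equiv.symm_apply_apply]
          rw [hinps]
          exact hne
        · simp only [copy]
          rw [dif_pos s.2, hidx]
    have hcard : ((Finset.univ.filter fun c => ¬ ∀ i ∈ S, zs c i = 0).card) +
        (Finset.univ.filter fun c => ∀ i ∈ S, zs c i = 0).card = m := by
      have := Finset.card_filter_add_card_filter_not (s := (Finset.univ : Finset (Fin m)))
        (fun c => ∀ i ∈ S, zs c i = 0)
      rw [Finset.card_univ, Fintype.card_fin] at this
      omega
    have hrun := runAutomaton_countStep inp copy N hcopy x N le_rfl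
    rw [himg] at hrun
    set B := Finset.univ.filter fun c => ¬ ∀ i ∈ S, zs c i = 0
    have hτ : (τ ≤ ((Finset.univ.filter fun c => ∀ i ∈ S, zs c i = 0).card : ℝ)) ↔
        τ ≤ (m : ℝ) - ((runAutomaton (fun s => countStep (copy s)) inp (0, ⊥) x N).1 : ℕ) := by
      rw [hrun, Fin.val_ofNat, Nat.mod_eq_of_lt (by omega)]
      rw [show (m : ℝ) = (B.card : ℝ) +
        ((Finset.univ.filter fun c => ∀ i ∈ S, zs c i = 0).card : ℝ) by exact_mod_cast hcard.symm,
        add_sub_cancel_left]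
    unfold zeroOn
    congr 1
    rw [eq_iff_iff, hτ]
    simp only [Finset.mem_image, Finset.mem_filter, Finset.mem_univ, true_and,
      forall_exists_index, and_imp]
    constructor
    · intro hall
      by_contra hcon
      have := hall _ _ hcon rfl
      rw [h2, if_pos rfl] at this
      exact one_ne_zero this
    · rintro hle i q hq rfl
      rw [h2, if_neg]
      rintro rfl
      exact hq hle

/-- Threshold tests on `m` copies: if `Λ` is an effect of complexity `G`, then counting the copies
on which `Λ` accepts is an effect of complexity polynomial in `m`, `G` and the number of qubits. -/
theorem exists_threshold_effect {ι : Type} [Fintype ι] [DecidableEq ι] {G : ℕ} {Λ : Op ι}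
    (hΛ : Λ ∈ effects ι G) :
    ∃ (X : Type) (_ : Fintype X) (acc : X → Bool) (P : Op ι → X → ℝ),
      (∀ ρ, IsState ρ → (∀ z, 0 ≤ P ρ z) ∧ ∑ z, P ρ z = 1 ∧
        expect Λ ρ = ∑ z, if acc z then P ρ z else 0) ∧
      ∀ (m : ℕ) (τ : ℝ), ∃ Λ' ∈ effects (Fin m × ι)
        (m * G + (1 + m * (Fintype.card ι + 2 * G) * ((m + 1) * (m + 1) * 10))),
        ∀ ρ, IsState ρ → expect Λ' (tensorPow ρ m) =
          ∑ zs : Fin m → X, if τ ≤ ((Finset.univ.filter fun c => acc (zs c)).card : ℝ) then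
            ∏ c, P ρ (zs c) else 0 := by
  obtain ⟨a, U, S, hU, hS, rfl⟩ := exists_of_mem_effects hΛ
  refine ⟨ι ⊕ Fin a → Fin 2, inferInstance, fun z => decide (∀ i ∈ S, z i = 0),
    fun ρ z => (outcomeAmp U ρ z).re, fun ρ hρ => ⟨fun z => ?_, ?_, ?_⟩, fun m τ => ?_⟩
  · exact (Complex.le_def.1 (outcomeAmp_nonneg U hρ.1 z)).1
  · rw [← Complex.re_sum, sum_outcomeAmp hU.mem_unitaryGroup hρ.2, Complex.one_re]
  · have := trace_conj_diagonal_mul U (zeroOn S) ρ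
    unfold expect
    refine (congrArg Complex.re this).trans ?_
    rw [Complex.re_sum]
    refine Finset.sum_congr rfl fun z _ => ?_
    simp only [zeroOn, decide_eq_true_eq]
    split_ifs <;> simp
  · obtain ⟨Y, iY, dY, φ, F, ⟨C, hC, hCd⟩, hφ⟩ := exists_threshold_circuit S m τ
    let e : (Fin m × ι) ⊕ ((Fin m × Fin a) ⊕ Y) ≃ (Fin m × (ι ⊕ Fin a)) ⊕ Y :=
      (Equiv.sumAssoc _ _ _).symm.trans
        (Equiv.sumCongr (Equiv.prodSumDistrib _ _ _).symm (Equiv.refl _))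
    have hpad : ∀ x : Fin m × ι → Fin 2, (fun r => Sum.elim x (fun _ => 0) (e.symm r)) =
        joinSlices (fun c => padZero (Fin a) fun i => x (c, i), fun _ : Y => 0) := by
      intro x
      ext1 r
      rcases r with ⟨c, i | j⟩ | y <;> rfl
    have hcirc := (hasCircuit_onCopies (Y := Y) (m := m) hU).mul hC
    refine ⟨_, effects_mono ?_ (mem_effects_of_hasCircuit e hcirc F), fun ρ hρ => ?_⟩
    · gcongr
    -- The counting circuit merely relabels the measured diagonal, so the only amplitudes left are
    -- those of `U` on the copies.
    have hconj : onCopies Y (fun _ : Fin m => U) * C * Matrix.diagonal (zeroOn F) *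
        (onCopies Y (fun _ : Fin m => U) * C).conjTranspose =
        onCopies Y (fun _ : Fin m => U) * Matrix.diagonal (zeroOn F ∘ φ) *
          (onCopies Y (fun _ : Fin m => U)).conjTranspose := by
      rw [Matrix.conjTranspose_mul, ← hCd]
      simp only [Matrix.mul_assoc]
    let thr : (Fin m → ι ⊕ Fin a → Fin 2) → ℂ := fun zs =>
      if τ ≤ ((Finset.univ.filter fun c => ∀ i ∈ S, zs c i = 0).card : ℝ) then 1 else 0
    have hentry : (Matrix.of fun x y : Fin m × ι → Fin 2 =>
        (onCopies Y (fun _ : Fin m => U) * C * Matrix.diagonal (zeroOn F) *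
          (onCopies Y (fun _ : Fin m => U) * C).conjTranspose)
          (fun r => Sum.elim x (fun _ => 0) (e.symm r))
          (fun r => Sum.elim y (fun _ => 0) (e.symm r))) =
        Matrix.of fun x y : Fin m × ι → Fin 2 =>
          ∑ zs, thr zs * ∏ c, (U (padZero (Fin a) fun i => x (c, i)) (zs c) *
            star (U (padZero (Fin a) fun i => y (c, i)) (zs c))) := by
      ext x y
      rw [Matrix.of_apply, Matrix.of_apply, hconj, hpad, hpad, conj_diagonal_apply]
      rw [← joinSlices.sum_comp, Fintype.sum_prod_type]
      refine Finset.sum_congr rfl fun zs _ => ?_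
      simp only [onCopies_joinSlices_left]
      -- The counting register starts in `0` and is untouched by the copies of `U`, so only its zero
      -- assignment contributes.
      rw [Finset.sum_eq_single fun _ => 0]
      · have h1 : ∀ xs : Fin m → ι ⊕ Fin a → Fin 2, (if (fun _ : Y => (0 : Fin 2)) =
            (fun r => joinSlices (zs, fun _ : Y => 0) (Sum.inr r)) then
              ∏ c, U (xs c) (slice (joinSlices (zs, fun _ : Y => 0)) c) else 0) =
              ∏ c, U (xs c) (zs c) := fun xs => if_pos rfl
        rw [h1, h1, Function.comp, hφ, star_prod, Finset.prod_mul_distrib]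
        ring
      · intro l _ hl
        have h1 : ∀ xs : Fin m → ι ⊕ Fin a → Fin 2, (if (fun _ : Y => (0 : Fin 2)) =
            (fun r => joinSlices (zs, l) (Sum.inr r)) then
              ∏ c, U (xs c) (slice (joinSlices (zs, l)) c) else 0) = 0 :=
          fun xs => if_neg fun h => hl h.symm
        rw [h1, zero_mul, zero_mul]
      · simp
    rw [hentry]
    have htrace : ((Matrix.of fun x y : Fin m × ι → Fin 2 =>
        ∑ zs, thr zs * ∏ c, (U (padZero (Fin a) fun i => x (c, i)) (zs c) *
          star (U (padZero (Fin a) fun i => y (c, i)) (zs c)))) * tensorPow ρ m).trace =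
        ∑ zs, thr zs * ∏ c, outcomeAmp U ρ (zs c) := by
      have hcurry : ∀ f : (Fin m × ι → Fin 2) → ℂ,
          ∑ x, f x = ∑ xs : Fin m → ι → Fin 2, f fun p => xs p.1 p.2 :=
        fun f => ((Equiv.curry (Fin m) ι (Fin 2)).symm.sum_comp f).symm
      simp only [Matrix.trace, Matrix.diag_apply, Matrix.mul_apply, Matrix.of_apply, tensorPow,
        hcurry, outcomeAmp, Fintype.prod_sum, Finset.sum_mul, Finset.mul_sum]
      rw [Finset.sum_congr rfl fun y _ => Finset.sum_comm, Finset.sum_comm]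
      refine Finset.sum_congr rfl fun zs _ => Finset.sum_congr rfl fun xs _ =>
        Finset.sum_congr rfl fun ys _ => ?_
      rw [mul_assoc, ← Finset.prod_mul_distrib]
    unfold expect
    rw [htrace, Complex.re_sum]
    refine Finset.sum_congr rfl fun zs _ => ?_
    have hprod : ∏ c, outcomeAmp U ρ (zs c) = ((∏ c, (outcomeAmp U ρ (zs c)).re : ℝ) : ℂ) := by
      rw [Complex.ofReal_prod]
      exact Finset.prod_congr rfl fun c _ => outcomeAmp_eq_ofReal U hρ.1 _
    simp only [decide_eq_true_eq]
    rw [hprod]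
    by_cases ht : τ ≤ ((Finset.univ.filter fun c => ∀ i ∈ S, zs c i = 0).card : ℝ)
    · rw [if_pos ht]
      simp only [thr, if_pos ht, one_mul, Complex.ofReal_re]
    · rw [if_neg ht]
      simp only [thr, if_neg ht, zero_mul, Complex.zero_re]

end CompInfo

namespace CompInfo

/-! ### Hoeffding's inequality for threshold tests -/

/-- Hoeffding's lemma for a variable with values in [0, 1]: after centring, the variance proxy is
(1/2)², hence the exponent l²/8. -/
theorem bernoulli_mgf_le {p : ℝ} (h0 : 0 ≤ p) (h1 : p ≤ 1) (l : ℝ) :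
    1 - p + p * Real.exp l ≤ Real.exp (l * p + l ^ 2 / 8) := by
  let μ : MeasureTheory.Measure ℝ := ProbabilityTheory.bernoulliMeasure 1 0 ⟨p, h0, h1⟩
  have hint : ∀ f : ℝ → ℝ, ∫ x, f x ∂μ = p * f 1 + (1 - p) * f 0 := fun f => by
    simpa using ProbabilityTheory.integral_bernoulliMeasure (1 : ℝ) 0 ⟨p, h0, h1⟩ f
  have hsub := ProbabilityTheory.hasSubgaussianMGF_of_mem_Icc (μ := μ) (X := fun x : ℝ => x)
    (a := 0) (b := 1) measurable_id.aemeasurable (by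
      have : μ (Set.Icc 0 1)ᶜ = 0 := by
        simp [μ, ProbabilityTheory.bernoulliMeasure_def]
      exact this)
  have h := hsub.mgf_le l
  rw [ProbabilityTheory.mgf, hint, hint] at h
  have hc : (((‖(1 : ℝ) - 0‖₊ / 2) ^ 2 : NNReal) : ℝ) = 1 / 4 := by norm_num
  rw [hc] at h
  simp only [mul_one, mul_zero, add_zero, zero_sub] at h
  calc 1 - p + p * Real.exp l
      = Real.exp (l * p) * (p * Real.exp (l * (1 - p)) + (1 - p) * Real.exp (l * -p)) := by
        have e1 : Real.exp l = Real.exp (l * p) * Real.exp (l * (1 - p)) := by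
          rw [← Real.exp_add]; ring_nf
        have e2 : Real.exp (l * p) * Real.exp (l * -p) = 1 := by
          rw [← Real.exp_add]; ring_nf; exact Real.exp_zero
        rw [e1]
        linear_combination (-(1 - p)) * e2
    _ ≤ Real.exp (l * p) * Real.exp (1 / 4 * l ^ 2 / 2) := by gcongr
    _ = _ := by rw [← Real.exp_add]; ring_nf

/-- Chernoff's method: the indicator of the event is at most exp(l(count - mt)), whose average over
independent copies is the `m`-th power of a one-copy sum. -/
theorem sum_threshold_le {X : Type} [Fintype X] (acc : X → Bool) {P : X → ℝ}
    (hP : ∀ z, 0 ≤ P z) (hP1 : ∑ z, P z = 1) (m : ℕ) {t : ℝ}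
    (ht : (∑ z, if acc z then P z else 0) ≤ t) :
    (∑ zs : Fin m → X, if m * t ≤ ((Finset.univ.filter fun c => acc (zs c)).card : ℝ) then
      ∏ c, P (zs c) else 0) ≤
      Real.exp (-(2 * m * (t - ∑ z, if acc z then P z else 0) ^ 2)) := by
  set p := ∑ z, if acc z then P z else 0 with hp
  have hp0 : 0 ≤ p := Finset.sum_nonneg fun z _ => by split_ifs <;> simp [hP]
  have hp1 : p ≤ 1 := by
    rw [← hP1]
    exact Finset.sum_le_sum fun z _ => by split_ifs <;> simp [hP]
  -- This `l` minimises the exponent -l(t - p) + l²/8, with minimum -2(t - p)².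
  set l := 4 * (t - p) with hl
  have hl0 : 0 ≤ l := by linarith
  have hmgf : ∑ z, P z * (if acc z then Real.exp l else 1) = 1 - p + p * Real.exp l := by
    have h1 : 1 - p + p * Real.exp l = ∑ z, P z - p + p * Real.exp l := by rw [hP1]
    rw [h1, hp, Finset.sum_mul, ← Finset.sum_sub_distrib, ← Finset.sum_add_distrib]
    exact Finset.sum_congr rfl fun z _ => by split_ifs <;> ring
  calc _ ≤ ∑ zs : Fin m → X, Real.exp (-(l * (m * t))) *
        ∏ c, (P (zs c) * (if acc (zs c) then Real.exp l else 1)) := by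
        refine Finset.sum_le_sum fun zs _ => ?_
        have hprod : ∏ c, (if acc (zs c) then Real.exp l else 1) =
            Real.exp (l * ((Finset.univ.filter fun c => acc (zs c)).card : ℝ)) := by
          rw [Finset.prod_ite, Finset.prod_const, Finset.prod_const_one, mul_one, mul_comm,
            Real.exp_nat_mul]
        have hnn : 0 ≤ ∏ c, P (zs c) := Finset.prod_nonneg fun c _ => hP _
        rw [Finset.prod_mul_distrib, hprod]
        split_ifs with hc
        · rw [mul_left_comm, ← Real.exp_add]
          refine le_mul_of_one_le_right hnn (Real.one_le_exp ?_)
          nlinarith [mul_le_mul_of_nonneg_left hc hl0]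
        · positivity
    _ = Real.exp (-(l * (m * t))) * (1 - p + p * Real.exp l) ^ m := by
        rw [← Finset.mul_sum, ← hmgf,
          Fintype.sum_pow fun z => P z * (if acc z then Real.exp l else 1)]
    _ ≤ Real.exp (-(l * (m * t))) * Real.exp (l * p + l ^ 2 / 8) ^ m := by
        have hnn : 0 ≤ 1 - p + p * Real.exp l := by
          have := mul_nonneg hp0 (Real.exp_pos l).le
          linarith
        exact mul_le_mul_of_nonneg_left (pow_le_pow_left₀ hnn (bernoulli_mgf_le hp0 hp1 l) m)
          (Real.exp_pos _).le
    _ = _ := by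
        rw [← Real.exp_nat_mul, ← Real.exp_add, hl]
        congr 1
        ring

/-! ### The bound for fixed states -/

section Pinsker

variable {ι : Type} [Fintype ι] [DecidableEq ι]

theorem expect_sub (Λ ρ σ : Op ι) : expect Λ (ρ - σ) = expect Λ ρ - expect Λ σ := by
  simp [expect, mul_sub, Matrix.trace_sub]

theorem le_hypRelEnt {ε r : ℝ} {ρ σ Λ : Op ι} {G : ℕ} (hΛ : Λ ∈ effects ι G)
    (h1 : 1 - ε ≤ expect Λ ρ) (h2 : expect Λ σ ≤ Real.exp (-r)) :
    (r : EReal) ≤ hypRelEnt ε ρ σ G := by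
  rw [hypRelEnt, EReal.le_neg]
  calc ENNReal.log (⨅ Λ ∈ {Λ ∈ effects ι G | 1 - ε ≤ expect Λ ρ}, ENNReal.ofReal (expect Λ σ))
      ≤ ENNReal.log (ENNReal.ofReal (Real.exp (-r))) :=
        ENNReal.log_monotone ((iInf₂_le Λ ⟨hΛ, h1⟩).trans (ENNReal.ofReal_le_ofReal h2))
    _ = -(r : EReal) := by
        rw [ENNReal.log_ofReal_of_pos (Real.exp_pos _), Real.log_exp, EReal.coe_neg]

theorem expect_mem_Icc {G : ℕ} {Λ ρ : Op ι} (hΛ : Λ ∈ effects ι G) (hρ : IsState ρ) :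
    0 ≤ expect Λ ρ ∧ expect Λ ρ ≤ 1 := by
  obtain ⟨X, _, acc, P, hP, -⟩ := exists_threshold_effect hΛ
  obtain ⟨h0, h1, h2⟩ := hP ρ hρ
  rw [h2]
  refine ⟨Finset.sum_nonneg fun z _ => by split_ifs <;> simp [h0], ?_⟩
  rw [← h1]
  exact Finset.sum_le_sum fun z _ => by split_ifs <;> simp [h0]

/-- Repeating the test `Λ` on `m` copies bounds the complexity-limited hypothesis testing relative
entropy from below. -/
theorem sq_le_hypRelEnt {G G' m : ℕ} {Λ ρ σ : Op ι} (hΛ : Λ ∈ effects ι G) (hρ : IsState ρ)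
    (hσ : IsState σ) {ε s : ℝ} (hε0 : 0 < ε) (hs : 0 ≤ s)
    (hms : Real.log (1 / ε) ≤ 2 * m * s ^ 2)
    (hG' : m * G + (1 + m * (Fintype.card ι + 2 * G) * ((m + 1) * (m + 1) * 10)) ≤ G') :
    ((2 * m * (max (expect Λ (ρ - σ) - s) 0) ^ 2 : ℝ) : EReal) ≤
      hypRelEnt ε (tensorPow ρ m) (tensorPow σ m) G' := by
  obtain ⟨X, _, acc, P, hP, hΛ'⟩ := exists_threshold_effect hΛ
  obtain ⟨hρ0, hρ1, hρ2⟩ := hP ρ hρ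
  obtain ⟨hσ0, hσ1, hσ2⟩ := hP σ hσ
  have htot : ∀ ρ, (∑ z, P ρ z = 1) → ∑ zs : Fin m → X, ∏ c, P ρ (zs c) = 1 := by
    intro ρ h
    rw [← Fintype.sum_pow, h, one_pow]
  rcases le_total (expect Λ (ρ - σ)) s with hle | hle
  -- The bound to be shown is `0`, and the test with threshold `0`, which always accepts, achieves
  -- it.
  · rw [max_eq_right (by linarith)]
    obtain ⟨Λ', hmem, hexp⟩ := hΛ' m 0
    have hone : ∀ ρ, IsState ρ → expect Λ' (tensorPow ρ m) = 1 := by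
      intro ρ hρ
      rw [hexp ρ hρ, ← htot ρ (hP ρ hρ).2.1]
      exact Finset.sum_congr rfl fun zs _ => if_pos (Nat.cast_nonneg _)
    refine le_hypRelEnt (effects_mono hG' hmem) ?_ ?_
    · rw [hone ρ hρ]; linarith
    · rw [hone σ hσ]; simp
  · rw [max_eq_left (by linarith)]
    -- Per copy, the threshold lies `s` below the mean under `ρ` and `expect Λ (ρ - σ) - s` above
    -- the mean under `σ`.
    obtain ⟨Λ', hmem, hexp⟩ := hΛ' m (m * (expect Λ ρ - s))
    rw [expect_sub] at hle ⊢
    refine le_hypRelEnt (effects_mono hG' hmem) ?_ ?_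
    · rw [hexp ρ hρ]
      have hcompl : (∑ z, if !acc z then P ρ z else 0) = 1 - expect Λ ρ := by
        rw [hρ2, ← hρ1, ← Finset.sum_sub_distrib]
        exact Finset.sum_congr rfl fun z _ => by cases acc z <;> simp
      have hbad := sum_threshold_le (fun z => !acc z) hρ0 hρ1 m (t := 1 - expect Λ ρ + s)
        (by rw [hcompl]; linarith)
      rw [hcompl, add_sub_cancel_left] at hbad
      have hε : Real.exp (-(2 * m * s ^ 2)) ≤ ε := by
        rw [← Real.le_log_iff_exp_le hε0]
        rw [one_div, Real.log_inv] at hms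
        linarith
      -- Accepting and rejecting copies add up to `m`, so missing the threshold forces at least m(1
      -- - Tr[Λρ] + s) rejections. The overlap of the two events does no harm to the inequality.
      have hsum : 1 - (∑ zs : Fin m → X,
          if (m : ℝ) * (1 - expect Λ ρ + s) ≤
            ((Finset.univ.filter fun c => !acc (zs c)).card : ℝ) then
          ∏ c, P ρ (zs c) else 0) ≤ ∑ zs : Fin m → X,
          if (m : ℝ) * (expect Λ ρ - s) ≤ ((Finset.univ.filter fun c => acc (zs c)).card : ℝ) then
          ∏ c, P ρ (zs c) else 0 := by
        rw [sub_le_iff_le_add, ← Finset.sum_add_distrib]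
        refine (htot ρ hρ1).symm.le.trans (Finset.sum_le_sum fun zs _ => ?_)
        have hnn : 0 ≤ ∏ c, P ρ (zs c) := Finset.prod_nonneg fun c _ => hρ0 _
        have hcard : ((Finset.univ.filter fun c => acc (zs c)).card : ℝ) +
            ((Finset.univ.filter fun c => !acc (zs c)).card : ℝ) = m := by
          have := Finset.card_filter_add_card_filter_not (s := (Finset.univ : Finset (Fin m)))
            (fun c => acc (zs c) = true)
          rw [Finset.card_univ, Fintype.card_fin] at this
          simp only [Bool.not_eq_true] at this
          simp only [Bool.not_eq_true']
          exact_mod_cast this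
        split_ifs with h1 h2 h2
        · linarith
        · linarith
        · linarith
        · push Not at h1 h2
          nlinarith
      linarith
    · rw [hexp σ hσ]
      have := sum_threshold_le acc hσ0 hσ1 m (t := expect Λ ρ - s) (by rw [← hσ2]; linarith)
      rw [← hσ2] at this
      refine this.trans (le_of_eq ?_)
      congr 2
      ring

theorem expect_sub_le_one {G : ℕ} {Λ ρ σ : Op ι} (hΛ : Λ ∈ effects ι G) (hρ : IsState ρ)
    (hσ : IsState σ) : expect Λ (ρ - σ) ≤ 1 := by
  rw [expect_sub]
  linarith [(expect_mem_Icc hΛ hρ).2, (expect_mem_Icc hΛ hσ).1]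

/-- The trivial effect bounds the supremum below by a real number, and `1` bounds it above. -/
theorem exists_dTV_eq {ρ σ : Op ι} (hρ : IsState ρ) (hσ : IsState σ) (G : ℕ) :
    ∃ d : ℝ, dTV ρ σ G = d := by
  have h1 : dTV ρ σ G ≤ ((1 : ℝ) : EReal) :=
    iSup₂_le fun Λ hΛ => EReal.coe_le_coe_iff.2 (expect_sub_le_one hΛ hρ hσ)
  have h0 : ((expect 1 (ρ - σ) : ℝ) : EReal) ≤ dTV ρ σ G :=
    le_iSup₂ (f := fun Λ (_ : Λ ∈ effects ι G) => (expect Λ (ρ - σ) : EReal)) 1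
      (effects_mono (Nat.zero_le _) one_mem_effects)
  lift dTV ρ σ G to ℝ using ⟨fun h => absurd h1 (by rw [h]; exact not_le.2 (EReal.coe_lt_top _)), fun h => by simp [h] at h0⟩ with d
  exact ⟨d, rfl⟩

end Pinsker

end CompInfo

namespace CompInfo

/-! ### Functions up to negligible differences -/

/-- As soon as an infinite value occurs, the difference is infinite; even `⊤ - ⊤` is `⊥`, of
absolute value `⊤`. -/
theorem exists_coe_of_abs_sub_ne_top {x y : EReal} (h : (x - y).abs ≠ ⊤) :
    ∃ a b : ℝ, x = a ∧ y = b ∧ (x - y).abs = ENNReal.ofReal |a - b| := by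
  induction x <;> induction y
  case coe.coe a b => exact ⟨a, b, rfl, rfl, by rw [← EReal.coe_sub, EReal.abs_def]⟩
  all_goals exact absurd (by simp) h

/-- Raising |f - g|^(1/log n) < exp(-j) to the power log n gives |f - g| < n^(-j). Two inequalities
replace the absolute value so that equal infinite values are covered. -/
theorem eventually_le_of_asympDist_lt {f g : ℕ → EReal} {j : ℕ}
    (h : asympDist f g < ENNReal.ofReal (Real.exp (-j))) :
    ∀ᶠ n : ℕ in atTop, f n ≤ g n + ((1 / (n : ℝ) ^ j : ℝ) : EReal) ∧
      g n ≤ f n + ((1 / (n : ℝ) ^ j : ℝ) : EReal) := by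
  filter_upwards [eventually_lt_of_limsup_lt h, eventually_ge_atTop 2] with n hn hn2
  have hnpos : (0 : ℝ) < n := by positivity
  have hnn : ((0 : ℝ) : EReal) ≤ ((1 / (n : ℝ) ^ j : ℝ) : EReal) :=
    EReal.coe_le_coe_iff.2 (by positivity)
  by_cases hfg : f n = g n
  · rw [hfg]
    exact ⟨le_add_of_nonneg_right hnn, le_add_of_nonneg_right hnn⟩
  rw [if_neg hfg] at hn
  have hlog : 0 < Real.log n := Real.log_pos (by exact_mod_cast hn2)
  have hlt : (f n - g n).abs < ENNReal.ofReal (1 / (n : ℝ) ^ j) := by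
    have h1 := ENNReal.rpow_lt_rpow hn hlog
    rw [← ENNReal.rpow_mul, one_div_mul_cancel hlog.ne', ENNReal.rpow_one,
      ENNReal.ofReal_rpow_of_pos (Real.exp_pos _)] at h1
    convert h1 using 2
    rw [← Real.exp_mul, neg_mul, Real.exp_neg, mul_comm, Real.exp_mul, Real.exp_log hnpos,
      Real.rpow_natCast, one_div]
  obtain ⟨a, b, ha, hb, hab⟩ := exists_coe_of_abs_sub_ne_top hlt.ne_top
  rw [hab, ENNReal.ofReal_lt_ofReal_iff (by positivity), abs_lt] at hlt
  rw [ha, hb, ← EReal.coe_add, ← EReal.coe_add, EReal.coe_le_coe_iff, EReal.coe_le_coe_iff]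
  constructor <;> linarith

theorem IsNegligible.eventually_le {h : ℕ → ℝ} (hh : IsNegligible h) (j : ℕ) :
    ∀ᶠ n : ℕ in atTop, h n ≤ 1 / (n : ℝ) ^ j := by
  have h1 : asympDist (fun n => (h n : EReal)) (fun _ => 0) < ENNReal.ofReal (Real.exp (-j)) := by
    rw [hh]
    exact ENNReal.ofReal_pos.2 (Real.exp_pos _)
  filter_upwards [eventually_le_of_asympDist_lt h1] with n hn
  have := hn.1
  rw [zero_add] at this
  exact EReal.coe_le_coe_iff.1 this

theorem isNegligible_of_eventually_le {h : ℕ → ℝ} (h0 : ∀ n, 0 ≤ h n)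
    (hh : ∀ j : ℕ, ∀ᶠ n : ℕ in atTop, h n ≤ 1 / (n : ℝ) ^ j) : IsNegligible h := by
  have hle : ∀ j : ℕ, asympDist (fun n => (h n : EReal)) (fun _ => 0) ≤
      ENNReal.ofReal (Real.exp (-j)) := by
    intro j
    refine limsup_le_of_le (by isBoundedDefault) ?_
    filter_upwards [hh j, eventually_ge_atTop 2] with n hn hn2
    split_ifs with hz
    · exact zero_le
    have hnpos : (0 : ℝ) < n := by positivity
    have hlog : 0 < Real.log n := Real.log_pos (by exact_mod_cast hn2)
    rw [sub_zero, EReal.abs_def, abs_of_nonneg (h0 n)]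
    calc ENNReal.ofReal (h n) ^ (1 / Real.log n)
        ≤ ENNReal.ofReal (1 / (n : ℝ) ^ j) ^ (1 / Real.log n) := by gcongr
      _ = ENNReal.ofReal (Real.exp (-j)) := by
        rw [ENNReal.ofReal_rpow_of_pos (by positivity)]
        congr 1
        rw [Real.rpow_def_of_pos (by positivity), one_div, Real.log_inv, Real.log_pow]
        congr 1
        field_simp
  have htend : Tendsto (fun j : ℕ => ENNReal.ofReal (Real.exp (-j))) atTop (𝓝 0) := by
    rw [← ENNReal.ofReal_zero]
    exact ENNReal.tendsto_ofReal (Real.tendsto_exp_neg_atTop_nhds_zero.comp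
      tendsto_natCast_atTop_atTop)
  exact le_antisymm (ge_of_tendsto' htend hle) zero_le

theorem NeglLE.of_eventually_le {f g : ℕ → EReal} (h : ∀ᶠ n in atTop, f n ≤ g n) : f ≲ₙ g :=
  ⟨fun _ => 0, isNegligible_of_eventually_le (fun _ => le_rfl)
    fun j => Eventually.of_forall fun n => by positivity, by simpa using h⟩

/-- One error function must serve all `j` at once. The smallest candidate, the positive part of f -
g, is bounded by each admissible error; in the infinite cases `toReal` makes it `0`, which is
enough. -/
theorem NeglLE.of_forall_pow {f g : ℕ → EReal}
    (h : ∀ j : ℕ, ∀ᶠ n : ℕ in atTop, f n ≤ g n + ((1 / (n : ℝ) ^ j : ℝ) : EReal)) : f ≲ₙ g := by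
  have key : ∀ {x y : EReal} {r : ℝ}, 0 ≤ r → x ≤ y + (r : EReal) →
      x ≤ y + ((max (x - y).toReal 0 : ℝ) : EReal) ∧ max (x - y).toReal 0 ≤ r := by
    intro x y r hr hxy
    induction y with
    | bot =>
      rw [EReal.bot_add, le_bot_iff] at hxy
      simp [hxy, hr]
    | top =>
      constructor
      · rw [EReal.top_add_coe]; exact le_top
      · induction x <;> simp [hr]
    | coe y =>
      induction x with
      | bot => simp [hr]
      | top =>
        rw [← EReal.coe_add, top_le_iff] at hxy
        exact absurd hxy (EReal.coe_ne_top _)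
      | coe x =>
        rw [← EReal.coe_sub, EReal.toReal_coe, ← EReal.coe_add, EReal.coe_le_coe_iff]
        rw [← EReal.coe_add, EReal.coe_le_coe_iff] at hxy
        exact ⟨by linarith [le_max_left (x - y) 0], max_le (by linarith) hr⟩
  refine ⟨fun n => max (f n - g n).toReal 0,
    isNegligible_of_eventually_le (fun n => le_max_right _ _) fun j => ?_, ?_⟩
  · filter_upwards [h j] with n hn
    exact (key (by positivity) hn).2
  · filter_upwards [h 0] with n hn
    exact (key (by positivity) hn).1

/-! ### Square roots -/

theorem esqrt_coe (x : ℝ) : esqrt x = (Real.sqrt x : ℝ) := by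
  have h : ((x : EReal).toENNReal ^ (1 / 2 : ℝ)) = ENNReal.ofReal (Real.sqrt x) := by
    rw [EReal.toENNReal_of_ne_top (EReal.coe_ne_top x), EReal.toReal_coe, Real.sqrt_eq_rpow]
    rcases le_total 0 x with hx | hx
    · rw [ENNReal.ofReal_rpow_of_nonneg hx (by norm_num)]
    · rw [ENNReal.ofReal_of_nonpos hx, ENNReal.zero_rpow_of_pos (by norm_num),
        ← Real.sqrt_eq_rpow, Real.sqrt_eq_zero_of_nonpos hx, ENNReal.ofReal_zero]
  rw [esqrt, h, EReal.coe_ennreal_ofReal, max_eq_left (Real.sqrt_nonneg x)]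

theorem esqrt_top : esqrt ⊤ = ⊤ := by
  rw [esqrt, EReal.toENNReal_top, ENNReal.top_rpow_of_pos (by norm_num), EReal.coe_ennreal_top]

theorem le_esqrt_of_sq_le {d s e : ℝ} {R : EReal} (he : 0 ≤ e)
    (h : ((2 * (max (d - s) 0) ^ 2 : ℝ) : EReal) ≤ R + (e : EReal)) :
    (d : EReal) ≤ esqrt (R / 2) + ((s + Real.sqrt (e / 2) : ℝ) : EReal) := by
  induction R with
  | bot =>
    rw [EReal.bot_add, le_bot_iff] at h
    exact absurd h (EReal.coe_ne_bot _)
  | top =>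
    have h2 : (⊤ : EReal) / 2 = ⊤ :=
      EReal.top_div_of_pos_ne_top (EReal.coe_pos.2 two_pos) (EReal.coe_ne_top 2)
    rw [h2, esqrt_top, EReal.top_add_coe]
    exact le_top
  | coe x =>
    rw [← EReal.coe_add, EReal.coe_le_coe_iff] at h
    have h2 : ((x : EReal) / 2) = ((x / 2 : ℝ) : EReal) := by
      rw [EReal.coe_div]; rfl
    rw [h2, esqrt_coe, ← EReal.coe_add, EReal.coe_le_coe_iff]
    have hmax : max (d - s) 0 ≤ Real.sqrt (x / 2) + Real.sqrt (e / 2) := by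
      have h3 : max (d - s) 0 ≤ Real.sqrt (x / 2 + e / 2) :=
        Real.le_sqrt_of_sq_le (by linarith)
      -- For `0 ≤ x` this is subadditivity of the square root. A negative `x` only lowers the
      -- left-hand radicand, and its own square root is `0`.
      rcases le_total 0 x with hx | hx
      · exact h3.trans (Real.sqrt_le_iff.2 ⟨by positivity, by
          nlinarith [Real.sq_sqrt (show 0 ≤ x / 2 by positivity), Real.sqrt_nonneg (x / 2),
            Real.sq_sqrt (show 0 ≤ e / 2 by positivity), Real.sqrt_nonneg (e / 2),
            mul_nonneg (Real.sqrt_nonneg (x / 2)) (Real.sqrt_nonneg (e / 2))]⟩)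
      · exact (h3.trans (Real.sqrt_le_sqrt (by linarith))).trans
          (le_add_of_nonneg_left (Real.sqrt_nonneg _))
    linarith [le_max_left (d - s) 0]

/-! ### The bound for the approximating quantities -/

/-- No optimal effect is needed: if the entropy is a real `r`, every advantage is at most s + √(r /
2m), and this passes to the supremum. -/
theorem sq_dTV_le_hypRelEnt {ι : Type} [Fintype ι] [DecidableEq ι] {G G' m : ℕ} {ρ σ : Op ι}
    (hρ : IsState ρ) (hσ : IsState σ) {ε s d : ℝ} (hd : dTV ρ σ G = d) (hm : 0 < m)
    (hε0 : 0 < ε) (hs : 0 ≤ s) (hms : Real.log (1 / ε) ≤ 2 * m * s ^ 2)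
    (hG' : m * G + (1 + m * (Fintype.card ι + 2 * G) * ((m + 1) * (m + 1) * 10)) ≤ G') :
    ((2 * m * (max (d - s) 0) ^ 2 : ℝ) : EReal) ≤
      hypRelEnt ε (tensorPow ρ m) (tensorPow σ m) G' := by
  have hmR : (0 : ℝ) < m := by exact_mod_cast hm
  have hall := fun Λ (hΛ : Λ ∈ effects ι G) => sq_le_hypRelEnt hΛ hρ hσ hε0 hs hms hG'
  have hone := hall 1 (effects_mono (Nat.zero_le _) one_mem_effects)
  generalize hypRelEnt ε (tensorPow ρ m) (tensorPow σ m) G' = H at hall hone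
  induction H with
  | bot => exact absurd (le_bot_iff.1 hone) (EReal.coe_ne_bot _)
  | top => exact le_top
  | coe r =>
    simp only [EReal.coe_le_coe_iff] at hall hone ⊢
    have hr : 0 ≤ r := le_trans (by positivity) hone
    have hle : dTV ρ σ G ≤ ((s + Real.sqrt (r / (2 * m)) : ℝ) : EReal) := by
      refine iSup₂_le fun Λ hΛ => EReal.coe_le_coe_iff.2 ?_
      have : max (expect Λ (ρ - σ) - s) 0 ≤ Real.sqrt (r / (2 * m)) := by
        refine Real.le_sqrt_of_sq_le ?_
        rw [le_div_iff₀ (by positivity)]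
        linarith [hall Λ hΛ]
      linarith [le_max_left (expect Λ (ρ - σ) - s) 0]
    rw [hd, EReal.coe_le_coe_iff] at hle
    have hmax : max (d - s) 0 ≤ Real.sqrt (r / (2 * m)) :=
      max_le (by linarith) (Real.sqrt_nonneg _)
    calc 2 * m * (max (d - s) 0) ^ 2 ≤ 2 * m * (Real.sqrt (r / (2 * m))) ^ 2 := by
          gcongr
      _ = r := by
          rw [Real.sq_sqrt (by positivity)]
          field_simp

/-- With M = n^k and A = n^(c + l), the left side is at most 122 M³A. The `7` in `hk` gives 128 A ≤
M, since 2^7 = 128, so M^5 is enough room. -/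
theorem circuit_size_le {n c l k ℓ Q : ℕ} (hn : 2 ≤ n) (hQ : Q ≤ n ^ c) (hk : c + l + 7 ≤ k)
    (hℓ : 5 ≤ ℓ) :
    n ^ k * n ^ l + (1 + n ^ k * (Q + 2 * n ^ l) * ((n ^ k + 1) * (n ^ k + 1) * 10)) ≤
      n ^ (k * ℓ) := by
  have h1 : ∀ a, 1 ≤ n ^ a := fun a => Nat.one_le_pow _ _ (by omega)
  set A := n ^ (c + l) with hA
  set M := n ^ k with hM
  have hc : n ^ c ≤ A := Nat.pow_le_pow_right (by omega) (by omega)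
  have hl : n ^ l ≤ A := Nat.pow_le_pow_right (by omega) (by omega)
  have hM1 : 1 ≤ M := h1 k
  have hA1 : 1 ≤ A := h1 _
  have hAM : 128 * A ≤ M := by
    calc 128 * A ≤ n ^ 7 * A := by
          gcongr
          calc 128 = 2 ^ 7 := by norm_num
            _ ≤ n ^ 7 := Nat.pow_le_pow_left hn 7
      _ = n ^ (7 + (c + l)) := by rw [pow_add]
      _ ≤ M := Nat.pow_le_pow_right (by omega) (by omega)
  have hfin : M ^ 5 ≤ n ^ (k * ℓ) := by
    rw [hM, ← pow_mul]
    exact Nat.pow_le_pow_right (by omega) (Nat.mul_le_mul_left k hℓ)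
  refine le_trans ?_ hfin
  calc M * n ^ l + (1 + M * (Q + 2 * n ^ l) * ((M + 1) * (M + 1) * 10))
      ≤ M * A + (M * A + M * (A + 2 * A) * ((M + M) * (M + M) * 10)) := by
        gcongr
        · exact Nat.one_le_iff_ne_zero.2 (by positivity)
        · exact hQ.trans hc
    _ = 2 * (M * A) + 120 * (M ^ 3 * A) := by ring
    _ ≤ 2 * (M ^ 3 * A) + 120 * (M ^ 3 * A) := by
        gcongr
        exact Nat.le_self_pow (by norm_num) M
    _ ≤ M ^ 3 * (128 * A) := by nlinarith [Nat.zero_le (M ^ 3 * A)]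
    _ ≤ M ^ 3 * M := by gcongr
    _ ≤ M ^ 5 := by
        rw [← pow_succ]
        exact Nat.pow_le_pow_right hM1 (by norm_num)

/-- Here m = n^k and s = n^(-j). The Hoeffding condition reads log(1/ε) ≤ 2 n^(k - 2j), which holds
for k ≥ 2j + 1 as soon as n ≥ log(1/ε). -/
theorem eventually_sq_le_polyRelEnt {q : ℕ → ℕ} {c : ℕ} (hq : ∀ᶠ n in atTop, q n ≤ n ^ c)
    {ρ σ : OpFamily q} (hρ : ∀ n, IsState (ρ n)) (hσ : ∀ n, IsState (σ n)) {l : ℕ} {d : ℕ → ℝ}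
    (hd : ∀ n, polyTV ρ σ l n = d n) {ε : ℝ} (hε0 : 0 < ε) {ℓ : ℕ} (hℓ : 5 ≤ ℓ) (j : ℕ) {k : ℕ}
    (hk : c + l + 7 ≤ k) (hkj : 2 * j + 1 ≤ k) :
    ∀ᶠ n : ℕ in atTop, ((2 * (max (d n - 1 / (n : ℝ) ^ j) 0) ^ 2 : ℝ) : EReal) ≤
      polyRelEnt ρ σ ε ℓ k n := by
  filter_upwards [hq, eventually_ge_atTop 2,
    tendsto_natCast_atTop_atTop.eventually_ge_atTop (Real.log (1 / ε))] with n hqn hn hlog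
  have hnpos : (0 : ℝ) < n := by positivity
  have hms : Real.log (1 / ε) ≤ 2 * ((n ^ k : ℕ) : ℝ) * (1 / (n : ℝ) ^ j) ^ 2 := by
    have h1 : (n : ℝ) ^ (2 * j + 1) ≤ (n : ℝ) ^ k :=
      pow_le_pow_right₀ (by exact_mod_cast (by omega : 1 ≤ n)) hkj
    have h2 : 2 * ((n ^ k : ℕ) : ℝ) * (1 / (n : ℝ) ^ j) ^ 2 = 2 * (n : ℝ) ^ k / (n : ℝ) ^ (2 * j) := by
      push_cast
      rw [div_pow, one_pow, ← pow_mul, mul_comm j 2]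
      ring
    rw [h2, le_div_iff₀ (by positivity)]
    calc Real.log (1 / ε) * (n : ℝ) ^ (2 * j) ≤ n * (n : ℝ) ^ (2 * j) := by gcongr
      _ = (n : ℝ) ^ (2 * j + 1) := by rw [pow_succ]; ring
      _ ≤ 2 * (n : ℝ) ^ k := by linarith [pow_pos hnpos k]
  have hnk : 0 < n ^ k := by positivity
  have h := sq_dTV_le_hypRelEnt (m := n ^ k) (G' := n ^ (k * ℓ)) (hρ n) (hσ n) (hd n) hnk hε0
    (by positivity) hms (by simpa using circuit_size_le hn hqn hk hℓ)
  rw [polyRelEnt, EReal.le_div_iff_mul_le (by exact_mod_cast hnk) (EReal.natCast_ne_top _)]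
  refine le_trans (le_of_eq ?_) h
  rw [← EReal.coe_coe_eq_natCast, ← EReal.coe_mul]
  congr 1
  ring

end CompInfo

/-! ### Passing to the limits in `k`, `ℓ` and `ε`. -/

theorem mainTheorem4 (q : ℕ → ℕ) (hq : ∃ c : ℕ, ∀ᶠ n in atTop, q n ≤ n ^ c)
    (ρ σ : OpFamily q) (hρ : ∀ n, IsState (ρ n)) (hσ : ∀ n, IsState (σ n)) :
    (∀ T D : ℕ → EReal, IsCompTV ρ σ T → IsCompRelEnt ρ σ D →
      T ≲ₙ fun n => esqrt (D n / 2)) ∧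
    (∀ ℓ₀ : ℕ, ∀ ε : ℝ, 0 < ε → ε < 1 → ∃ ℓ₁ : ℕ, ∀ ℓ ≥ ℓ₁, ∀ j : ℕ, ∀ᶠ k in atTop,
      polyTV ρ σ ℓ₀ ≲ₙ fun n =>
        esqrt (polyRelEnt ρ σ ε ℓ k n / 2) + ((1 / (n : ℝ) ^ j : ℝ) : EReal)) := by
  obtain ⟨c, hq⟩ := hq
  refine ⟨fun T D hT ⟨E, E', hE, hD⟩ => NeglLE.of_forall_pow fun i => ?_,
    fun l ε hε0 _ => ⟨5, fun ℓ hℓ j => ?_⟩⟩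
  -- The extra power of `n` absorbs the constant `4` in front of the accumulated error n^(-j).
  · set j := i + 1 with hj
    have hpos : ∀ a : ℕ, 0 < ENNReal.ofReal (Real.exp (-a)) := fun a =>
      ENNReal.ofReal_pos.2 (Real.exp_pos _)
    obtain ⟨l, hl⟩ := (hT.eventually_lt_const (hpos j)).exists
    obtain ⟨ε, ⟨⟨hEε, hE'⟩, hDε⟩, hε0⟩ :=
      ((hE.and (hD.eventually_lt_const (hpos (2 * j)))).and self_mem_nhdsWithin).exists
    obtain ⟨ℓ, ⟨hinf, hEℓ⟩, hℓ⟩ :=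
      ((hEε.and (hE'.eventually_lt_const (hpos (2 * j)))).and (eventually_ge_atTop 5)).exists
    choose d hd using fun n => exists_dTV_eq (hρ n) (hσ n) (n ^ l)
    -- The lower bound is the same function for all large `k`, so the upper bound property of the
    -- limit inferior applies to it; that the bound is least plays no role.
    obtain ⟨h, hh, hgE⟩ := hinf.1
      (fun n => ((2 * (max (d n - 1 / (n : ℝ) ^ j) 0) ^ 2 : ℝ) : EReal)) (by
        filter_upwards [eventually_ge_atTop (c + l + 7), eventually_ge_atTop (2 * j + 1)]
          with k hk hkj
        exact NeglLE.of_eventually_le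
          (eventually_sq_le_polyRelEnt hq hρ hσ hd hε0 hℓ j hk hkj))
    filter_upwards [eventually_le_of_asympDist_lt hl, eventually_le_of_asympDist_lt hDε,
      eventually_le_of_asympDist_lt hEℓ, hgE, hh.eventually_le (2 * j), eventually_ge_atTop 4]
      with n h1 h2 h3 h4 h5 hn
    have hnpos : (0 : ℝ) < n := by positivity
    set u : ℝ := 1 / (n : ℝ) ^ j with hu
    have hu0 : 0 < u := by positivity
    have hu2 : 1 / (n : ℝ) ^ (2 * j) = u ^ 2 := by
      rw [hu, div_pow, one_pow, ← pow_mul, mul_comm]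
    rw [hu2] at h2 h3 h5
    -- The three errors u² come from the negligible `h`, from the limit in ℓ and from the limit in
    -- ε. They were taken with exponent `2 * j` so that the square root turns them into multiples of
    -- `u`.
    have hsq : ((2 * (max (d n - u) 0) ^ 2 : ℝ) : EReal) ≤ D n + ((3 * u ^ 2 : ℝ) : EReal) := by
      calc ((2 * (max (d n - u) 0) ^ 2 : ℝ) : EReal)
          ≤ D n + ((u ^ 2 : ℝ) : EReal) + ((u ^ 2 : ℝ) : EReal) + ((u ^ 2 : ℝ) : EReal) :=
            h4.trans (add_le_add (h3.1.trans (add_le_add h2.1 le_rfl))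
              (EReal.coe_le_coe_iff.2 h5))
        _ = D n + ((3 * u ^ 2 : ℝ) : EReal) := by
            rw [add_assoc, add_assoc, ← EReal.coe_add, ← EReal.coe_add]
            congr 2
            ring
    have hmain := le_esqrt_of_sq_le (by positivity) hsq
    have hsqrt : Real.sqrt (3 * u ^ 2 / 2) ≤ 2 * u :=
      Real.sqrt_le_iff.2 ⟨by positivity, by nlinarith⟩
    calc T n ≤ (d n : EReal) + (u : EReal) := by rw [← hd n]; exact h1.2
      _ ≤ esqrt (D n / 2) + ((u + Real.sqrt (3 * u ^ 2 / 2) : ℝ) : EReal) + (u : EReal) :=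
          add_le_add hmain le_rfl
      _ = esqrt (D n / 2) + ((u + Real.sqrt (3 * u ^ 2 / 2) + u : ℝ) : EReal) := by
          rw [add_assoc, ← EReal.coe_add]
      _ ≤ esqrt (D n / 2) + ((1 / (n : ℝ) ^ i : ℝ) : EReal) := by
          refine add_le_add le_rfl (EReal.coe_le_coe_iff.2 ?_)
          have hn4 : (4 : ℝ) ≤ n := by exact_mod_cast hn
          have hui : 1 / (n : ℝ) ^ i = n * u := by
            rw [hu, hj, pow_succ]
            field_simp
          rw [hui]
          nlinarith
  · choose d hd using fun n => exists_dTV_eq (hρ n) (hσ n) (n ^ l)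
    filter_upwards [eventually_ge_atTop (c + l + 7), eventually_ge_atTop (2 * j + 1)] with k hk hkj
    refine NeglLE.of_eventually_le ?_
    filter_upwards [eventually_sq_le_polyRelEnt hq hρ hσ hd hε0 hℓ j hk hkj] with n hn
    -- No limit is taken here, so the margin n^(-j) of the threshold is the only error.
    have := le_esqrt_of_sq_le (e := 0) le_rfl (hn.trans_eq (add_zero _).symm)
    rw [zero_div, Real.sqrt_zero, add_zero] at this
    rw [polyTV, hd n]
    exact this
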